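/- Let $(X_i,Z_i)_{i\ge 1}$ be i.i.d. uniform on $[0,1]^2$, let $(\xi_i)_{i\ge1}$ be i.i.d. real errors, independent of the sequence $(X_i,Z_i)_{i\ge1}$, with $\mathbb{E}\,\xi_1=0$ and $\|\xi_1\|_{2,1}:=\int_0^\infty \mathbb{P}(|\xi_1|>t)^{1/2}\,dt<\infty$, and let $$Y_i=\phi_0(X_i,Z_i)+\xi_i,\qquad i\ge 1,$$ where $\phi_0:[0,1]^2\to\mathbb{R}$ is measurable and bounded. Let $\mathcal F$ be either the class of all non-decreasing functions on $[0,1]$ (isotonic model) or the class of all convex functions on $[0,1]$ (convex model). Let $\mathcal H$ be a class of measurable functions on $[0,1]$ with $\int_0^1 h(z)\,dz=0$ for every $h\in\mathcal H$, which has a square integrable envelope: there is $H:[0,1]\to[0,\infty)$ with $\int_0^1 H(z)^2\,dz<\infty$ and $|h(z)|\le H(z)$ for all $h\in\mathcal H$ and $z\in[0,1]$. (No boundedness or entropy condition is imposed on $\mathcal H$, and $H$ need not be continuous.) For each $n\ge 1$ let, almost surely, $$(\hat f_n,\hat h_n)\in\operatorname*{arg\,min}_{(f,h)\in\mathcal F\times\mathcal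 H}\ \sum_{i=1}^n\big(Y_i-f(X_i)-h(Z_i)\big)^2,$$ where $\hat f_n$ is the canonical version of the estimator. That is, with $X_{(1)}<\dots<X_{(n)}$ the ordered covariates: in the isotonic model $\hat f_n$ is constant on $[0,X_{(1)}]$, on each $(X_{(k)},X_{(k+1)}]$ and on $[X_{(n)},1]$ (so it is the left-continuous piecewise constant function determined by its values at the design points); in the convex model, $\hat f_n$ is the piecewise linear function on $[0,1]$ with kinks contained in $\{X_{(2)},\dots,X_{(n-1)}\}$ (so it interpolates its values at the design points linearly, and its first and last linear pieces extend to $0$ and to $1$). Then, in both the isotonic and the convex model, $\hat f_n$ is stochastically bounded in supremum norm, $\|\hat f_n\|_\infty=\mathcal O_{\mathbf P}(1)$: for every $\varepsilon>0$ there is $K<\infty$ such that, for all sufficiently large $n$, $$\mathbb{P}\Big(\sup_{x\in[0,1]}|\hat f_n(x)|>K\Big)\le\varepsilon .$$ (No measurability in $\omega$ of $\hat f_n,\hat h_n$ is assumed; $\mathbb{P}$ is the outer probability where needed.) -/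

import Mathlib

open MeasureTheory ProbabilityTheory Set Filter
open scoped ENNReal NNReal

/-- The `L_{p,1}` norm `∫₀^∞ P(|ξ| > t)^{1/p} dt` of a random variable, with values in `[0, ∞]`. -/
noncomputable def lorentzNorm {Ω : Type*} [MeasurableSpace Ω] (p : ℝ) (ξ : Ω → ℝ)
    (μ : Measure Ω) : ℝ≥0∞ :=
  ∫⁻ t in Ioi (0 : ℝ), μ {ω | t < |ξ ω|} ^ (1 / p)

/-- The supremum norm over `[0,1]`, with values in `[0, ∞]`. -/
noncomputable def supNorm (f : ℝ → ℝ) : ℝ≥0∞ :=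
  ⨆ x ∈ Icc (0 : ℝ) 1, ‖f x‖ₑ

/-- `R n = O_P(1)`: for every `ε > 0` there is a finite `K` with `P(R n > K) ≤ ε` for all large `n`.
(On a set that is not measurable, `μ` is the outer probability.) -/
def StochasticallyBounded {Ω : Type*} [MeasurableSpace Ω] (μ : Measure Ω)
    (R : ℕ → Ω → ℝ≥0∞) : Prop :=
  ∀ ε : ℝ≥0∞, 0 < ε → ∃ K : ℝ≥0, ∀ᶠ n in atTop, μ {ω | (K : ℝ≥0∞) < R n ω} ≤ ε

/-- The uniform distribution on `[0,1]`. -/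
noncomputable def uniformLaw : Measure ℝ := volume.restrict (Icc 0 1)

/-- The isotonic model. Functions on `[0,1]` are represented by functions on `ℝ`, whose values
outside `[0,1]` are irrelevant. -/
def isotonicModel : Set (ℝ → ℝ) := {f | MonotoneOn f (Icc 0 1)}

/-- The convex model. -/
def convexModel : Set (ℝ → ℝ) := {f | ConvexOn ℝ (Icc 0 1) f}

/-- The residual sum of squares of the additive fit `f(x) + h(z)`, for `p = (f, h)`. -/
def residualSumSq {n : ℕ} (x z y : Fin n → ℝ) (p : (ℝ → ℝ) × (ℝ → ℝ)) : ℝ :=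
  ∑ i, (y i - p.1 (x i) - p.2 (z i)) ^ 2

/-- `(f, h)` is a least squares estimator over the additive model `{f(x) + h(z) : f ∈ F, h ∈ H}`. -/
def IsAdditiveLSE (F H : Set (ℝ → ℝ)) {n : ℕ} (x z y : Fin n → ℝ) (f h : ℝ → ℝ) : Prop :=
  (f, h) ∈ F ×ˢ H ∧ IsMinOn (residualSumSq x z y) (F ×ˢ H) (f, h)

/-- `f` is, on `[0,1]`, the left-continuous piecewise constant function determined by its values at
the design points: with the distinct design points in increasing order `x₁ < ⋯ < xₘ`, it is constant
on `[0, x₁]`, on each `(xₖ, xₖ₊₁]`, and on `[xₘ, 1]`. -/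
def IsCanonicalStep {n : ℕ} (x : Fin n → ℝ) (f : ℝ → ℝ) : Prop :=
  (∀ t ∈ Icc (0 : ℝ) 1, ∀ i, t ≤ x i → (∀ j, t ≤ x j → x i ≤ x j) → f t = f (x i)) ∧
  (∀ t ∈ Icc (0 : ℝ) 1, ∀ i, x i ≤ t → (∀ j, x j ≤ x i) → f t = f (x i))

/-- `f` is, on `[0,1]`, the piecewise linear function determined by its values at the design points:
with the distinct design points in increasing order `x₁ < ⋯ < xₘ`, it is affine between consecutive
ones, its first linear piece extends to `0` and its last one to `1`. Equivalently, it is affine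
on each interval in whose interior there is no design point other than `x₁` and `xₘ`. -/
def IsCanonicalPiecewiseLinear {n : ℕ} (x : Fin n → ℝ) (f : ℝ → ℝ) : Prop :=
  ∀ a b : ℝ, 0 ≤ a → a < b → b ≤ 1 →
    (∀ i, x i ∈ Ioo a b → (∀ j, x i ≤ x j) ∨ (∀ j, x j ≤ x i)) →
    ∃ c d : ℝ, ∀ t ∈ Icc a b, f t = c + d * t

/-! For fixed `ĥ`, the function `f̂` is the least squares fit over `F` of the responses `w i = Y i -
ĥ (Z i)`, and `|w i| ≤ T i := B + |ξ i| + env (Z i)` whatever `ĥ` is. The complexity of `H`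
therefore never enters. Moreover `|ξ i|` and `env (Z i)` are each independent of `X i` and square
integrable, so Chebyshev's inequality at the lengths `2^k / n` and a geometric union bound control
the sums of the `T i` over all intervals at an endpoint. What remains is deterministic.

Isotonic model: the lowest level set of `f̂` is an initial segment of the design, and the fitted
value there is at least the mean of `w` over it (`neg_div_le_of_isotonic`). The sum of `T` over that
segment and its number of points are both of order `n t + 1`, so this mean is bounded. Reflection
gives the upper bound.

Convex model: comparison with `0` bounds `∑ f̂ (X i) ^ 2` by a multiple of `n`, so `f̂` is bounded
at some design point of each of four intervals. Convexity turns this into a lower bound on `[0,1]`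
and an upper bound on `[1/8, 7/8]`. Near `0`, let `τ` be the first kink, `d < 0` the slope before
it, and compare `f̂` with its modification that continues a steeper supporting line to the left of
`τ` (`apply_zero_le_of_convex`). The variational inequality becomes `f̂ τ * ∑ (τ - X i)₊ - d * ∑ (τ
- X i)₊ ^ 2 ≤ ∑ w i * (τ - X i)₊`, which bounds `f̂ τ` and `-d * τ`, hence `f̂ 0`. This needs `∑ (τ
- X i)₊ ^ 2` to be at least of order `(n τ + 1) τ ^ 2` (`holdsWhp_le_sum_sq_initial`). -/

/-! ### Least squares over a convex class -/

/-- `f` is a least squares fit of the responses `w` over the class `F`. -/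
def IsLeastSquaresFit (F : Set (ℝ → ℝ)) {n : ℕ} (x w : Fin n → ℝ) (f : ℝ → ℝ) : Prop :=
  f ∈ F ∧ ∀ g ∈ F, ∑ i, (w i - f (x i)) ^ 2 ≤ ∑ i, (w i - g (x i)) ^ 2

/-- Only competitors with the same second component are used, so `h` enters solely through the
responses. -/
lemma IsAdditiveLSE.isLeastSquaresFit {F H : Set (ℝ → ℝ)} {n : ℕ} {x z y : Fin n → ℝ}
    {f h : ℝ → ℝ} (H1 : IsAdditiveLSE F H x z y f h) :
    IsLeastSquaresFit F x (fun i => y i - h (z i)) f := by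
  obtain ⟨⟨hf, hh⟩, hmin⟩ := H1
  refine ⟨hf, fun g hg => ?_⟩
  have e : ∀ k : ℝ → ℝ, ∑ i, (y i - h (z i) - k (x i)) ^ 2 = residualSumSq x z y (k, h) :=
    fun k => Finset.sum_congr rfl fun i _ => by ring
  rw [e, e]
  exact hmin (show (g, h) ∈ F ×ˢ H from ⟨hg, hh⟩)

/-- The variational inequality characterizing projections onto a convex class. -/
lemma IsLeastSquaresFit.sum_mul_sub_nonpos {F : Set (ℝ → ℝ)} (hF : Convex ℝ F) {n : ℕ}
    {x w : Fin n → ℝ} {f g : ℝ → ℝ} (hf : IsLeastSquaresFit F x w f) (hg : g ∈ F) :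
    ∑ i, (w i - f (x i)) * (g (x i) - f (x i)) ≤ 0 := by
  by_contra! hpos
  set a := ∑ i, (w i - f (x i)) * (g (x i) - f (x i)) with ha
  set b := ∑ i, (g (x i) - f (x i)) ^ 2 with hb
  have hb0 : 0 ≤ b := Finset.sum_nonneg fun i _ => sq_nonneg _
  -- A step along the segment from `f` to `g` so short that the first-order gain `2 * e * a` beats
  -- the second-order loss `e ^ 2 * b`; the `+ 1` covers `b = 0`.
  set e := min 1 (a / (b + 1)) with he
  have he0 : 0 < e := lt_min one_pos (by positivity)
  have he1 : e ≤ 1 := min_le_left _ _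
  have hea : e * (b + 1) ≤ a := by
    have : e ≤ a / (b + 1) := min_le_right _ _
    rwa [le_div_iff₀ (by positivity)] at this
  have hmem : (1 - e) • f + e • g ∈ F :=
    hF hf.1 hg (by linarith) he0.le (by ring)
  have key := hf.2 _ hmem
  have : ∑ i, (w i - ((1 - e) • f + e • g) (x i)) ^ 2
      = ∑ i, (w i - f (x i)) ^ 2 - 2 * e * a + e ^ 2 * b := by
    rw [ha, hb, Finset.mul_sum, Finset.mul_sum, ← Finset.sum_sub_distrib,
      ← Finset.sum_add_distrib]
    refine Finset.sum_congr rfl fun i _ => ?_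
    simp only [Pi.add_apply, Pi.smul_apply, smul_eq_mul]
    ring
  rw [this] at key
  have h2 : 2 * a ≤ e * b := by
    have : e * (2 * a) ≤ e * (e * b) := by nlinarith
    exact le_of_mul_le_mul_left this he0
  nlinarith

/-- Compare with the zero function and write `f = w - (w - f)`. -/
lemma IsLeastSquaresFit.sum_sq_le {F : Set (ℝ → ℝ)} (hF : 0 ∈ F) {n : ℕ}
    {x w : Fin n → ℝ} {f : ℝ → ℝ} (hf : IsLeastSquaresFit F x w f) :
    ∑ i, f (x i) ^ 2 ≤ 4 * ∑ i, w i ^ 2 := by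
  have h := hf.2 0 hF
  simp only [Pi.zero_apply, sub_zero] at h
  have : ∑ i, f (x i) ^ 2 ≤ ∑ i, (2 * (w i - f (x i)) ^ 2 + 2 * w i ^ 2) :=
    Finset.sum_le_sum fun i _ => by nlinarith [sq_nonneg (2 * w i - f (x i))]
  rw [Finset.sum_add_distrib, ← Finset.mul_sum, ← Finset.mul_sum] at this
  linarith

lemma convex_isotonicModel : Convex ℝ isotonicModel := by
  intro f hf g hg a b ha hb _ x hx y hy hxy
  have h1 := mul_le_mul_of_nonneg_left (hf hx hy hxy) ha
  have h2 := mul_le_mul_of_nonneg_left (hg hx hy hxy) hb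
  simpa using add_le_add h1 h2

lemma convex_convexModel : Convex ℝ convexModel := by
  intro f hf g hg a b ha hb _
  exact (ConvexOn.smul ha hf).add (ConvexOn.smul hb hg)

/-! ### Reflection -/

lemma IsLeastSquaresFit.reflect_isotonic {n : ℕ} {x w : Fin n → ℝ} {f : ℝ → ℝ}
    (hf : IsLeastSquaresFit isotonicModel x w f) :
    IsLeastSquaresFit isotonicModel (fun i => 1 - x i) (fun i => -w i) (fun t => -f (1 - t)) := by
  have refl : ∀ g ∈ isotonicModel, (fun t => -g (1 - t)) ∈ isotonicModel := by
    intro g hg s hs t ht hst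
    have := hg (a := 1 - t) (b := 1 - s) ⟨by linarith [ht.2], by linarith [ht.1]⟩
      ⟨by linarith [hs.2], by linarith [hs.1]⟩ (by linarith)
    simpa using this
  refine ⟨refl f hf.1, fun g hg => ?_⟩
  have := hf.2 _ (refl g hg)
  simp only [sub_sub_cancel] at this ⊢
  convert this using 2 <;> ring

lemma ConvexOn.reflect {g : ℝ → ℝ} (hg : ConvexOn ℝ (Icc 0 1) g) :
    ConvexOn ℝ (Icc 0 1) (fun t => g (1 - t)) := by
  refine ⟨convex_Icc _ _, fun s hs t ht a b ha hb hab => ?_⟩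
  have := hg.2 (x := 1 - s) (y := 1 - t) ⟨by linarith [hs.2], by linarith [hs.1]⟩
      ⟨by linarith [ht.2], by linarith [ht.1]⟩ ha hb hab
  have e : a • (1 - s) + b • (1 - t) = 1 - (a • s + b • t) := by
    simp only [smul_eq_mul]; linear_combination hab
  rwa [e] at this

lemma IsLeastSquaresFit.reflect_convex {n : ℕ} {x w : Fin n → ℝ} {f : ℝ → ℝ}
    (hf : IsLeastSquaresFit convexModel x w f) :
    IsLeastSquaresFit convexModel (fun i => 1 - x i) w (fun t => f (1 - t)) := by
  refine ⟨hf.1.reflect, fun g hg => ?_⟩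
  have := hf.2 (fun t => g (1 - t)) (ConvexOn.reflect hg)
  simpa only [sub_sub_cancel] using this

lemma IsCanonicalPiecewiseLinear.reflect {n : ℕ} {x : Fin n → ℝ} {f : ℝ → ℝ}
    (hf : IsCanonicalPiecewiseLinear x f) :
    IsCanonicalPiecewiseLinear (fun i => 1 - x i) (fun t => f (1 - t)) := by
  intro a b ha hab hb h
  obtain ⟨c, d, hcd⟩ := hf (1 - b) (1 - a) (by linarith) (by linarith) (by linarith) (by
    intro i hi
    rcases h i ⟨by linarith [hi.2], by linarith [hi.1]⟩ with h | h
    · exact Or.inr fun j => by linarith [h j]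
    · exact Or.inl fun j => by linarith [h j])
  refine ⟨c + d, -d, fun t ht => ?_⟩
  change f (1 - t) = _
  rw [hcd (1 - t) ⟨by linarith [ht.2], by linarith [ht.1]⟩]
  ring

/-! ### The isotonic model -/

/-- By monotonicity the set `L` where the minimal value `m` is attained is an initial segment of the
design. Raising `f` slightly on `L` alone keeps it monotone, so optimality forces `m` to be at least
the mean of `w` over `L`. One factor `K` bounds the sum of `|w i|`, the other the number of points.
-/
lemma IsLeastSquaresFit.neg_div_le_of_isotonic {n : ℕ} {x w : Fin n → ℝ} {f : ℝ → ℝ}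
    (hf : IsLeastSquaresFit isotonicModel x w f) (hx : ∀ i, x i ∈ Icc (0 : ℝ) 1) {K : ℝ}
    (hK : 0 ≤ K) (h1 : ∀ t ∈ Icc (0 : ℝ) 1, ∑ i with x i ≤ t, |w i| ≤ K * (n * t + 1))
    (h2 : ∀ j, n * x j + 1 ≤ K * (Finset.univ.filter fun i => x i ≤ x j).card) (i : Fin n) :
    -(K * K) ≤ f (x i) := by
  obtain ⟨i₀, -, hi₀⟩ := Finset.exists_min_image Finset.univ (fun i => f (x i)) ⟨i, Finset.mem_univ i⟩
  refine le_trans ?_ (hi₀ i (Finset.mem_univ i))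
  set m := f (x i₀) with hm
  set L := Finset.univ.filter fun i => f (x i) = m with hL
  have hLne : L.Nonempty := ⟨i₀, by simp [hL, hm]⟩
  obtain ⟨j, hjL, hj⟩ := Finset.exists_max_image L x hLne
  have hfj : f (x j) = m := by simpa [hL] using hjL
  have hLeq : L = Finset.univ.filter fun i => x i ≤ x j := by
    ext k
    simp only [hL, Finset.mem_filter, Finset.mem_univ, true_and]
    constructor
    · intro hk; exact hj k (by simp [hL, hk])
    · intro hk
      exact le_antisymm (hfj ▸ hf.1 (hx k) (hx j) hk) (hi₀ k (Finset.mem_univ k))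
  -- `c` is the next larger fitted value, so that `max f c` changes the fit only on `L`; if there is
  -- no larger value, any number above `m` serves.
  obtain ⟨c, hmc, hc⟩ : ∃ c, m < c ∧ ∀ k, f (x k) ≠ m → c ≤ f (x k) := by
    by_cases hne : (Finset.univ.filter fun i => f (x i) ≠ m).Nonempty
    · obtain ⟨k, hk, hk'⟩ := Finset.exists_min_image _ (fun i => f (x i)) hne
      refine ⟨f (x k), lt_of_le_of_ne (hi₀ k (Finset.mem_univ k)) ?_, fun l hl => hk' l (by simp [hl])⟩
      exact fun h => (by simpa using hk : f (x k) ≠ m) h.symm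
    · refine ⟨m + 1, by linarith, fun k hk => (hne ⟨k, by simp [hk]⟩).elim⟩
  have hg : (fun t => max (f t) c) ∈ isotonicModel := fun s hs t ht hst =>
    max_le_max (hf.1 hs ht hst) le_rfl
  have hv := hf.sum_mul_sub_nonpos convex_isotonicModel hg
  have hsum : ∑ i, (w i - f (x i)) * (max (f (x i)) c - f (x i))
      = (c - m) * (∑ i ∈ L, w i - m * L.card) := by
    rw [mul_comm m, ← nsmul_eq_mul, ← Finset.sum_const, ← Finset.sum_sub_distrib, Finset.mul_sum, hL,
      Finset.sum_filter]
    refine Finset.sum_congr rfl fun k _ => ?_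
    split_ifs with h
    · rw [h, max_eq_right hmc.le]; ring
    · rw [max_eq_left (hc k h)]; ring
  rw [hsum] at hv
  have hv' : ∑ i ∈ L, w i ≤ m * L.card := by
    by_contra! h
    have := mul_pos (sub_pos.2 hmc) (sub_pos.2 h)
    linarith
  have hw : -(K * (n * x j + 1)) ≤ ∑ i ∈ L, w i := by
    have h3 := h1 (x j) (hx j)
    rw [← hLeq] at h3
    have := (Finset.abs_sum_le_sum_abs w L).trans h3
    linarith [(abs_le.1 this).1]
  have hcard : (0 : ℝ) < L.card := by exact_mod_cast hLne.card_pos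
  have h4 := h2 j
  rw [← hLeq] at h4
  have h5 : -(K * K) * L.card ≤ m * L.card := by nlinarith
  exact le_of_mul_le_mul_right h5 hcard

lemma supNorm_le_of_forall {f : ℝ → ℝ} {K : ℝ} (h : ∀ t ∈ Icc (0 : ℝ) 1, |f t| ≤ K) :
    supNorm f ≤ ENNReal.ofReal K := by
  refine iSup₂_le fun t ht => ?_
  rw [← ofReal_norm, Real.norm_eq_abs]
  exact ENNReal.ofReal_le_ofReal (h t ht)

lemma IsCanonicalStep.exists_eq {n : ℕ} [NeZero n] {x : Fin n → ℝ} {f : ℝ → ℝ}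
    (hf : IsCanonicalStep x f) {t : ℝ} (ht : t ∈ Icc (0 : ℝ) 1) : ∃ i, f t = f (x i) := by
  by_cases hne : (Finset.univ.filter fun i => t ≤ x i).Nonempty
  · obtain ⟨i, hi, hi'⟩ := Finset.exists_min_image _ x hne
    exact ⟨i, hf.1 t ht i (by simpa using hi) fun j hj => hi' j (by simpa using hj)⟩
  · obtain ⟨i, -, hi⟩ := Finset.exists_max_image Finset.univ x ⟨0, Finset.mem_univ _⟩
    refine ⟨i, hf.2 t ht i ?_ fun j => hi j (Finset.mem_univ j)⟩
    by_contra! h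
    exact hne ⟨i, by simp [h.le]⟩

/-! ### The convex model -/

lemma ConvexOn.le_of_lt_of_lt {f : ℝ → ℝ} {a b c : ℝ} {s : Set ℝ} (hf : ConvexOn ℝ s f)
    (ha : a ∈ s) (hc : c ∈ s) (hab : a < b) (hbc : b < c) :
    (c - a) * f b ≤ (c - b) * f a + (b - a) * f c := by
  have hca : 0 < c - a := by linarith
  have h₁ : 0 ≤ (c - b) / (c - a) := div_nonneg (by linarith) hca.le
  have h₂ : 0 ≤ (b - a) / (c - a) := div_nonneg (by linarith) hca.le
  have := hf.2 ha hc h₁ h₂ (by field_simp; ring)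
  have e : ((c - b) / (c - a)) • a + ((b - a) / (c - a)) • c = b := by
    simp only [smul_eq_mul]; field_simp; ring
  rw [e] at this
  simp only [smul_eq_mul] at this
  calc (c - a) * f b ≤ (c - a) * ((c - b) / (c - a) * f a + (b - a) / (c - a) * f c) := by gcongr
    _ = _ := by field_simp

/-- A convex function which is bounded at a point of each of four intervals is bounded below
on `[0,1]`. -/
lemma ConvexOn.neg_le_of_bounded_at {f : ℝ → ℝ} (hf : ConvexOn ℝ (Icc 0 1) f) {M p₁ p₂ p₃ p₄ : ℝ}
    (hp₁ : p₁ ∈ Icc (0 : ℝ) (1 / 8)) (hp₂ : p₂ ∈ Icc (3 / 8 : ℝ) (1 / 2))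
    (hp₃ : p₃ ∈ Icc (1 / 2 : ℝ) (5 / 8)) (hp₄ : p₄ ∈ Icc (7 / 8 : ℝ) 1)
    (h₁ : |f p₁| ≤ M) (h₂ : |f p₂| ≤ M) (h₃ : |f p₃| ≤ M) (h₄ : |f p₄| ≤ M)
    {x : ℝ} (hx : x ∈ Icc (0 : ℝ) 1) : -(8 * M) ≤ f x := by
  rw [abs_le] at h₁ h₂ h₃ h₄
  obtain ⟨hx0, hx1⟩ := hx
  obtain ⟨a1, b1⟩ := hp₁
  obtain ⟨a2, b2⟩ := hp₂
  obtain ⟨a3, b3⟩ := hp₃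
  obtain ⟨a4, b4⟩ := hp₄
  have hM : 0 ≤ M := by linarith
  -- For `x` left of `1/2`, `p₃` lies between `x` and `p₄`, and the chord inequality gives `(p₄ -
  -- p₃) * f x ≥ -2 * M`; since `p₄ - p₃ ≥ 1/4`, the factor is `8`. The other half is symmetric.
  rcases le_total x (1 / 2) with h | h
  · rcases eq_or_lt_of_le (h.trans a3) with e | hlt
    · rw [e]; linarith
    have key := hf.le_of_lt_of_lt (a := x) (b := p₃) (c := p₄) ⟨hx0, hx1⟩ ⟨by linarith, b4⟩ hlt
      (by linarith)
    have : (p₄ - p₃) * (-(8 * M)) ≤ (p₄ - p₃) * f x := by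
      nlinarith [mul_le_mul_of_nonneg_left h₄.2 (show 0 ≤ p₃ - x by linarith),
        mul_le_mul_of_nonneg_left h₃.1 (show 0 ≤ p₄ - x by linarith)]
    exact le_of_mul_le_mul_left this (by linarith)
  · rcases eq_or_lt_of_le (b2.trans h) with e | hlt
    · rw [← e]; linarith
    have key := hf.le_of_lt_of_lt (a := p₁) (b := p₂) (c := x) ⟨a1, by linarith⟩ ⟨hx0, hx1⟩
      (by linarith) hlt
    have : (p₂ - p₁) * (-(8 * M)) ≤ (p₂ - p₁) * f x := by
      nlinarith [mul_le_mul_of_nonneg_left h₁.2 (show 0 ≤ x - p₂ by linarith),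
        mul_le_mul_of_nonneg_left h₂.1 (show 0 ≤ x - p₁ by linarith)]
    exact le_of_mul_le_mul_left this (by linarith)

lemma ConvexOn.le_of_bounded_at {f : ℝ → ℝ} (hf : ConvexOn ℝ (Icc 0 1) f) {M p₁ p₄ : ℝ}
    (hp₁ : p₁ ∈ Icc (0 : ℝ) (1 / 8)) (hp₄ : p₄ ∈ Icc (7 / 8 : ℝ) 1)
    (h₁ : |f p₁| ≤ M) (h₄ : |f p₄| ≤ M)
    {x : ℝ} (hx : x ∈ Icc (1 / 8 : ℝ) (7 / 8)) : f x ≤ M :=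
  (hf.le_max_of_mem_Icc (x := p₁) (y := p₄) ⟨hp₁.1, by linarith [hp₁.2]⟩
    ⟨by linarith [hp₄.1], hp₄.2⟩ ⟨hp₁.2.trans hx.1, hx.2.trans hp₄.1⟩).trans
    (max_le (abs_le.1 h₁).2 (abs_le.1 h₄).2)

/-- Replacing a convex function to the left of a point by a supporting line at that point
keeps it convex. -/
lemma ConvexOn.extend_supporting_line {f : ℝ → ℝ} (hf : ConvexOn ℝ (Icc 0 1) f) {τ s : ℝ}
    (hτ : τ ∈ Icc (0 : ℝ) 1) (hs : ∀ t ∈ Icc (0 : ℝ) 1, f τ + s * (t - τ) ≤ f t) :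
    ConvexOn ℝ (Icc 0 1) (fun t => f (max t τ) + s * (t - max t τ)) := by
  -- Subtracting the slope makes `f t - s * t` minimal at `τ`, hence nondecreasing on `[τ, 1]`. Its
  -- composition with the convex map `max t τ` is therefore convex, and adding `s * t` back gives
  -- the claimed function.
  have hid : ConvexOn ℝ (Icc (0 : ℝ) 1) fun t => max t τ :=
    (convexOn_id (convex_Icc _ _)).sup (convexOn_const τ (convex_Icc _ _))
  have himg : (fun t => max t τ) '' Icc (0 : ℝ) 1 = Icc τ 1 := by
    ext y
    constructor
    · rintro ⟨t, ht, rfl⟩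
      exact ⟨le_max_right _ _, max_le ht.2 hτ.2⟩
    · intro hy
      exact ⟨y, ⟨hτ.1.trans hy.1, hy.2⟩, max_eq_left hy.1⟩
  have hlin : ∀ c : ℝ, ConvexOn ℝ (Icc (0 : ℝ) 1) fun t => c * t := fun c =>
    (LinearMap.mulLeft ℝ c).convexOn (convex_Icc _ _)
  have hF : ConvexOn ℝ (Icc (0 : ℝ) 1) fun t => f t + (-s) * t := hf.add (hlin (-s))
  have hF' : ConvexOn ℝ (Icc τ 1) fun t => f t + (-s) * t :=
    hF.subset (Icc_subset_Icc_left hτ.1) (convex_Icc _ _)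
  have hmono : MonotoneOn (fun t => f t + (-s) * t) (Icc τ 1) := by
    intro a ha b hb hab
    rcases eq_or_lt_of_le ha.1 with e | hlt
    · subst e
      have := hs b ⟨hτ.1.trans hb.1, hb.2⟩
      simp only
      linarith
    rcases eq_or_lt_of_le hab with e | hlt'
    · rw [e]
    have key := hF'.le_of_lt_of_lt (a := τ) (b := a) (c := b) ⟨le_rfl, hτ.2⟩ hb hlt hlt'
    have h1 := hs a ⟨hτ.1.trans ha.1, ha.2⟩
    have h2 : f τ + -s * τ ≤ f a + -s * a := by linarith
    simp only at key ⊢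
    have : (a - τ) * (f a + -s * a) ≤ (a - τ) * (f b + -s * b) := by
      nlinarith [mul_le_mul_of_nonneg_left h2 (show 0 ≤ b - a by linarith)]
    exact le_of_mul_le_mul_left this (by linarith)
  have hcomp : ConvexOn ℝ (Icc (0 : ℝ) 1)
      ((fun t => f t + (-s) * t) ∘ fun t => max t τ) :=
    ConvexOn.comp (by rwa [himg]) hid (by rwa [himg])
  refine (hcomp.add (hlin s)).congr fun t _ => ?_
  simp only [Function.comp, Pi.add_apply]
  ring

/-- A canonical convex piecewise linear function is affine on `[0, 1/4]`, or there is a design point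
in `(0, 1/4]` up to which it is affine, with a supporting line of strictly larger slope there. -/
lemma exists_first_kink {n : ℕ} {x : Fin n → ℝ} {f : ℝ → ℝ}
    (hx : ∀ i, x i ∈ Icc (0 : ℝ) 1) (hcan : IsCanonicalPiecewiseLinear x f)
    (hconv : ConvexOn ℝ (Icc 0 1) f) {i₀ j₀ : Fin n} (hij : x i₀ < x j₀) (hj₀ : 1 / 4 < x j₀) :
    (∃ c d, ∀ t ∈ Icc (0 : ℝ) (1 / 4), f t = c + d * t) ∨
    ∃ i j c d s, x i < x j ∧ x j ≤ 1 / 4 ∧ (∀ t ∈ Icc 0 (x j), f t = c + d * t) ∧ d < s ∧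
      ∀ t ∈ Icc (0 : ℝ) 1, f (x j) + s * (t - x j) ≤ f t := by
  classical
  -- the design points that are not the smallest one
  obtain ⟨i₁, -, hi₁⟩ := Finset.exists_min_image Finset.univ x ⟨i₀, Finset.mem_univ _⟩
  have hmin : ∀ i, x i₁ ≤ x i := fun i => hi₁ i (Finset.mem_univ i)
  obtain ⟨j₁, hj₁, hj₁'⟩ := Finset.exists_min_image (Finset.univ.filter fun j => x i₁ < x j) x
    ⟨j₀, by simpa using (hmin i₀).trans_lt hij⟩
  have hj₁lt : x i₁ < x j₁ := by simpa using hj₁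
  -- The canonical form has no kink at the smallest design point, so the first piece reaches the
  -- second distinct one. Hence a kink always has a design point strictly to its left.
  have haff₁ : ∃ c d, ∀ t ∈ Icc (0 : ℝ) (x j₁), f t = c + d * t := by
    refine hcan 0 (x j₁) le_rfl ((hx i₁).1.trans_lt hj₁lt) (hx j₁).2 fun i hi => Or.inl ?_
    have : ¬ x i₁ < x i := fun h => absurd (hj₁' i (by simpa using h)) (not_le.2 hi.2)
    exact fun k => (not_lt.1 this).trans (hmin k)
  obtain ⟨j, hj, hj'⟩ := Finset.exists_max_image (Finset.univ.filter fun j =>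
    x i₁ < x j ∧ ∃ c d, ∀ t ∈ Icc (0 : ℝ) (x j), f t = c + d * t) x
    ⟨j₁, Finset.mem_filter.2 ⟨Finset.mem_univ _, hj₁lt, haff₁⟩⟩
  simp only [Finset.mem_filter, Finset.mem_univ, true_and] at hj hj'
  obtain ⟨hlt, c, d, hcd⟩ := hj
  by_cases hq : 1 / 4 < x j
  · exact Or.inl ⟨c, d, fun t ht => hcd t ⟨ht.1, ht.2.trans hq.le⟩⟩
  push Not at hq
  obtain ⟨k, hk, hk'⟩ := Finset.exists_min_image (Finset.univ.filter fun k => x j < x k) x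
    ⟨j₀, by simpa using hq.trans_lt hj₀⟩
  have hjk : x j < x k := by simpa using hk
  obtain ⟨c', s, hcs⟩ := hcan (x j) (x k) (hx j).1 hjk (hx k).2 fun i hi =>
    absurd (hk' i (by simpa using hi.1)) (not_le.2 hi.2)
  have hj0 : 0 < x j := (hx i₁).1.trans_lt hlt
  have e1 := hcd (x j) ⟨hj0.le, le_rfl⟩
  have e2 := hcs (x j) ⟨le_rfl, hjk.le⟩
  have e3 := hcs (x k) ⟨hjk.le, le_rfl⟩
  have e0 := hcd 0 ⟨le_rfl, hj0.le⟩
  have hds : d ≤ s := by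
    have := hconv.le_of_lt_of_lt (a := 0) (b := x j) (c := x k) (by simp) (hx k) hj0 hjk
    have h1 : f (x k) = f (x j) + s * (x k - x j) := by rw [e3, e2]; ring
    have h2 : f 0 = f (x j) - d * x j := by rw [e0, e1]; ring
    rw [h1, h2] at this
    have h3 : (x j * (x k - x j)) * d ≤ (x j * (x k - x j)) * s := by linarith
    exact le_of_mul_le_mul_left h3 (mul_pos hj0 (by linarith))
  -- Equal slopes would prolong the affine piece from `0` to `x k`, against the maximality of `x j`.
  have hne : d ≠ s := by
    rintro rfl
    have hcc : c' = c := by linarith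
    refine absurd (hj' k ⟨hlt.trans hjk, c, d, fun t ht => ?_⟩) (not_le.2 hjk)
    rcases le_total t (x j) with h | h
    · exact hcd t ⟨ht.1, h⟩
    · rw [hcs t ⟨h, ht.2⟩, hcc]
  refine Or.inr ⟨i₁, j, c, d, s, hlt, hq, hcd, lt_of_le_of_ne hds hne, fun t ht => ?_⟩
  rcases le_total t (x j) with h | h
  · rw [hcd t ⟨ht.1, h⟩, e1]
    nlinarith [mul_nonneg (sub_nonneg.2 hds) (sub_nonneg.2 h)]
  · rcases le_total t (x k) with h' | h'
    · rw [hcs t ⟨h, h'⟩, e2]; linarith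
    rcases eq_or_lt_of_le h' with e | hlt'
    · rw [← e, e3, e2]; linarith
    have := hconv.le_of_lt_of_lt (a := x j) (b := x k) (c := t) (hx j) ht hjk hlt'
    have h1 : f (x k) = f (x j) + s * (x k - x j) := by rw [e3, e2]; ring
    rw [h1] at this
    have h3 : (x k - x j) * (f (x j) + s * (t - x j)) ≤ (x k - x j) * f t := by linarith
    exact le_of_mul_le_mul_left h3 (by linarith)

/-- The essential case is a first kink `τ ≤ 1/4` with negative slope `d` before it, where `f 0 = f τ
+ (-d) * τ`. Testing optimality against the supporting-line modification gives one inequality, from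
which `f τ ≤ K * K` and `(-d) * τ ≤ K * K * (1 + M)` follow separately. -/
lemma IsLeastSquaresFit.apply_zero_le_of_convex {n : ℕ} {x w : Fin n → ℝ} {f : ℝ → ℝ}
    (hf : IsLeastSquaresFit convexModel x w f) (hcan : IsCanonicalPiecewiseLinear x f)
    (hx : ∀ i, x i ∈ Icc (0 : ℝ) 1) {K M : ℝ} (hK : 0 ≤ K) (hM : 0 ≤ M)
    (hlow : ∀ t ∈ Icc (0 : ℝ) 1, -M ≤ f t) (hup : ∀ t ∈ Icc (1 / 8 : ℝ) (7 / 8), f t ≤ M)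
    {i₀ j₀ : Fin n} (hij : x i₀ < x j₀) (hj₀ : 1 / 4 < x j₀)
    (h1 : ∀ t ∈ Icc (0 : ℝ) 1, ∑ i with x i ≤ t, |w i| ≤ K * (n * t + 1))
    (h2 : ∀ t ∈ Icc (0 : ℝ) 1, ((Finset.univ.filter fun i => x i ≤ t).card : ℝ) ≤ K * (n * t + 1))
    (h3 : ∀ i j, x i < x j → (n * x j + 1) * x j ^ 2 ≤ K * ∑ i, max (x j - x i) 0 ^ 2) :
    f 0 ≤ 3 * M + K * K * (2 + M) := by
  have hKK : 0 ≤ K * K * (2 + M) := by positivity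
  have hconv : ConvexOn ℝ (Icc 0 1) f := hf.1
  rcases exists_first_kink hx hcan hconv hij hj₀ with ⟨c, d, hcd⟩ | ⟨i, j, c, d, s, hlt, hq, hcd, hds, hs⟩
  -- Here `f 0 = 2 * f (1/8) - f (1/4)`.
  · have e0 := hcd 0 ⟨by norm_num, by norm_num⟩
    have e1 := hcd (1 / 8) ⟨by norm_num, by norm_num⟩
    have e2 := hcd (1 / 4) ⟨by norm_num, by norm_num⟩
    have := hup (1 / 8) ⟨by norm_num, by norm_num⟩
    have := hlow (1 / 4) ⟨by norm_num, by norm_num⟩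
    linarith
  set τ := x j with hτ
  have hτ0 : 0 < τ := (hx i).1.trans_lt hlt
  have e0 := hcd 0 ⟨le_rfl, hτ0.le⟩
  have eτ := hcd τ ⟨hτ0.le, le_rfl⟩
  have h14 := hup (1 / 4) ⟨by norm_num, by norm_num⟩
  -- If `d ≥ 0`, convexity gives `f 0 ≤ f (1/4) ≤ M`.
  rcases le_or_gt 0 d with hd | hd
  · rcases eq_or_lt_of_le hq with e | hlt'
    · rw [e] at eτ hτ0
      nlinarith
    have := hconv.le_of_lt_of_lt (a := 0) (b := τ) (c := 1 / 4) (by simp)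
      ⟨by norm_num, by norm_num⟩ hτ0 hlt'
    have h4 : f 0 ≤ f τ := by rw [e0, eτ]; nlinarith
    have : τ * f 0 ≤ τ * M := by nlinarith
    have := le_of_mul_le_mul_left this hτ0
    linarith
  have hg : (fun t => f (max t τ) + s * (t - max t τ)) ∈ convexModel :=
    hconv.extend_supporting_line (hx j) hs
  have hv := hf.sum_mul_sub_nonpos convex_convexModel hg
  have hdiff : ∀ i, f (max (x i) τ) + s * (x i - max (x i) τ) - f (x i)
      = -(s - d) * max (τ - x i) 0 := by
    intro i
    rcases le_total (x i) τ with h | h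
    · rw [max_eq_right h, max_eq_left (by linarith), hcd (x i) ⟨(hx i).1, h⟩, eτ]; ring
    · rw [max_eq_left h, max_eq_right (by linarith)]; ring
  have hfi : ∀ i, f (x i) * max (τ - x i) 0
      = f τ * max (τ - x i) 0 + (-d) * max (τ - x i) 0 ^ 2 := by
    intro i
    rcases le_total (x i) τ with h | h
    · rw [max_eq_left (by linarith), hcd (x i) ⟨(hx i).1, h⟩, eτ]; ring
    · rw [max_eq_right (by linarith)]; ring
  set S1 := ∑ i, max (τ - x i) 0 with hS1
  set S2 := ∑ i, max (τ - x i) 0 ^ 2 with hS2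
  -- The competitor differs from `f` by `-(s - d) * (τ - x)₊`. The positive factor `s - d` cancels,
  -- so the size of the slope change is immaterial.
  have hW : f τ * S1 + (-d) * S2 ≤ ∑ i, w i * max (τ - x i) 0 := by
    have e : ∑ i, (w i - f (x i)) * (f (max (x i) τ) + s * (x i - max (x i) τ) - f (x i))
        = -(s - d) * (∑ i, w i * max (τ - x i) 0 - (f τ * S1 + (-d) * S2)) := by
      rw [hS1, hS2, Finset.mul_sum, Finset.mul_sum, ← Finset.sum_add_distrib,
        ← Finset.sum_sub_distrib, Finset.mul_sum]
      refine Finset.sum_congr rfl fun i _ => ?_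
      rw [hdiff, ← hfi]; ring
    rw [e] at hv
    by_contra! h
    nlinarith [mul_pos (sub_pos.2 hds) (sub_pos.2 h)]
  set q := (n : ℝ) * τ + 1 with hq'
  have hq0 : 0 < q := by positivity
  have hWle : ∑ i, w i * max (τ - x i) 0 ≤ τ * (K * q) := by
    calc ∑ i, w i * max (τ - x i) 0 ≤ ∑ i, if x i ≤ τ then τ * |w i| else 0 := by
          refine Finset.sum_le_sum fun i _ => ?_
          split_ifs with h
          · rw [max_eq_left (by linarith), mul_comm]
            have := (hx i).1
            nlinarith [le_abs_self (w i), abs_nonneg (w i)]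
          · rw [max_eq_right (by linarith), mul_zero]
      _ = τ * ∑ i with x i ≤ τ, |w i| := by rw [← Finset.sum_filter, Finset.mul_sum]
      _ ≤ _ := by gcongr; exact h1 τ (hx j)
  have hS1le : S1 ≤ τ * (K * q) := by
    calc S1 ≤ ∑ i, if x i ≤ τ then τ else 0 := by
          refine Finset.sum_le_sum fun i _ => ?_
          split_ifs with h
          · rw [max_eq_left (by linarith)]; linarith [(hx i).1]
          · rw [max_eq_right (by linarith)]
      _ = τ * (Finset.univ.filter fun i => x i ≤ τ).card := by
          rw [← Finset.sum_filter, Finset.sum_const, nsmul_eq_mul, mul_comm]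
      _ ≤ _ := by gcongr; exact h2 τ (hx j)
  have hS10 : 0 ≤ S1 := Finset.sum_nonneg fun i _ => le_max_right _ _
  have hS20 : 0 ≤ S2 := Finset.sum_nonneg fun i _ => sq_nonneg _
  have hS2S1 : S2 ≤ τ * S1 := by
    rw [hS1, hS2, Finset.mul_sum]
    refine Finset.sum_le_sum fun i _ => ?_
    rw [sq]
    gcongr
    exact max_le (by linarith [(hx i).1]) hτ0.le
  have hS2ge : q * τ ^ 2 ≤ K * S2 := h3 i j hlt
  have hfτ := hlow τ (hx j)
  -- Move `f τ * S1 ≥ -M * S1` to the right and use the lower bound on `S2`.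
  have hστ : (-d) * τ ≤ K * K * (1 + M) := by
    have a1 : (-d) * S2 ≤ τ * (K * q) * (1 + M) := by nlinarith
    have a2 : (-d) * (q * τ ^ 2) ≤ K * (τ * (K * q) * (1 + M)) := by
      calc (-d) * (q * τ ^ 2) ≤ (-d) * (K * S2) := by
            apply mul_le_mul_of_nonneg_left hS2ge (by linarith)
        _ = K * ((-d) * S2) := by ring
        _ ≤ _ := by gcongr
    have a3 : (q * τ) * ((-d) * τ) ≤ (q * τ) * (K * K * (1 + M)) := by linarith
    exact le_of_mul_le_mul_left a3 (by positivity)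
  -- If `f τ > 0`, the term `(-d) * S2 ≥ 0` can be dropped, and `S2 ≤ τ * S1` bounds `S1` from
  -- below.
  have hfτ' : f τ ≤ K * K := by
    by_contra! h
    have hpos : 0 < f τ := lt_of_le_of_lt (by positivity) h
    have b1 : f τ * S1 ≤ τ * (K * q) := by nlinarith
    have b2 : q * τ ^ 2 ≤ K * (τ * S1) := hS2ge.trans (by gcongr)
    have b3 : f τ * (q * τ ^ 2) ≤ K * K * (q * τ ^ 2) := by
      calc f τ * (q * τ ^ 2) ≤ f τ * (K * (τ * S1)) := by gcongr
        _ = K * τ * (f τ * S1) := by ring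
        _ ≤ K * τ * (τ * (K * q)) := by gcongr
        _ = _ := by ring
    exact absurd (le_of_mul_le_mul_right b3 (by positivity)) (not_le.2 h)
  have : f 0 = f τ + (-d) * τ := by rw [e0, eτ]; ring
  nlinarith

/-! ### Properties that hold with high probability -/

/-- The property `P K n` holds, for large `n`, with probability as close to one as desired when the
constant `K` is large. -/
def HoldsWhp {Ω : Type*} [MeasurableSpace Ω] (μ : Measure Ω) (P : ℝ → ℕ → Ω → Prop) : Prop :=
  ∀ δ : ℝ, 0 < δ → ∃ K₀ : ℝ, ∀ K, K₀ ≤ K → ∀ᶠ n in atTop, μ {ω | ¬ P K n ω} ≤ ENNReal.ofReal δ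

section HoldsWhp

variable {Ω : Type*} [MeasurableSpace Ω] {μ : Measure Ω} {P Q : ℝ → ℕ → Ω → Prop}

lemma HoldsWhp.of_mono (mP : ∀ K K' n ω, K ≤ K' → P K n ω → P K' n ω)
    (h : ∀ δ : ℝ, 0 < δ → ∃ K : ℝ, ∀ᶠ n in atTop, μ {ω | ¬ P K n ω} ≤ ENNReal.ofReal δ) :
    HoldsWhp μ P := by
  intro δ hδ
  obtain ⟨K, hK⟩ := h δ hδ
  refine ⟨K, fun K' hKK' => ?_⟩
  filter_upwards [hK] with n hn
  refine (measure_mono ?_).trans hn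
  intro ω hω hP
  exact hω (mP _ _ _ _ hKK' hP)

lemma HoldsWhp.and (hP : HoldsWhp μ P) (hQ : HoldsWhp μ Q) :
    HoldsWhp μ fun K n ω => P K n ω ∧ Q K n ω := by
  intro δ hδ
  obtain ⟨K₁, e1⟩ := hP (δ / 2) (by positivity)
  obtain ⟨K₂, e2⟩ := hQ (δ / 2) (by positivity)
  refine ⟨max K₁ K₂, fun K hK => ?_⟩
  filter_upwards [e1 K ((le_max_left _ _).trans hK), e2 K ((le_max_right _ _).trans hK)] with n f1 f2
  have : {ω | ¬ (P K n ω ∧ Q K n ω)} ⊆ {ω | ¬ P K n ω} ∪ {ω | ¬ Q K n ω} := by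
    intro ω hω
    by_contra hcon
    simp only [mem_union, mem_ofPred_eq, not_or, not_not] at hcon
    exact hω hcon
  calc _ ≤ _ := measure_mono this
    _ ≤ _ := measure_union_le _ _
    _ ≤ ENNReal.ofReal (δ / 2) + ENNReal.ofReal (δ / 2) := add_le_add f1 f2
    _ = _ := by rw [← ENNReal.ofReal_add (by positivity) (by positivity), add_halves]

/-- Deterministic bounds are transferred to probability here. `φ` is evaluated at a single constant,
so it need not be monotone. -/
lemma HoldsWhp.imp (hP : HoldsWhp μ P) (mQ : ∀ K K' n ω, K ≤ K' → Q K n ω → Q K' n ω) (φ : ℝ → ℝ)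
    (h : ∀ K, 1 ≤ K → ∀ᶠ n in atTop, ∀ᵐ ω ∂μ, P K n ω → Q (φ K) n ω) : HoldsWhp μ Q := by
  refine HoldsWhp.of_mono mQ fun δ hδ => ?_
  obtain ⟨K₀, e1⟩ := hP δ hδ
  refine ⟨φ (max 1 K₀), ?_⟩
  filter_upwards [e1 _ (le_max_right 1 K₀), h _ (le_max_left _ _)] with n f1 f2
  refine (measure_mono_ae ?_).trans f1
  filter_upwards [f2] with ω hω hn
  exact fun hp => hn (hω hp)

lemma HoldsWhp.stochasticallyBounded {R : ℕ → Ω → ℝ≥0∞}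
    (h : HoldsWhp μ fun K n ω => R n ω ≤ ENNReal.ofReal K) : StochasticallyBounded μ R := by
  intro ε hε
  obtain ⟨δ, hδ, hδε⟩ : ∃ δ : ℝ, 0 < δ ∧ ENNReal.ofReal δ ≤ ε := by
    rcases eq_or_ne ε ∞ with rfl | hne
    · exact ⟨1, one_pos, le_top⟩
    · exact ⟨ε.toReal, ENNReal.toReal_pos hε.ne' hne, ENNReal.ofReal_toReal_le⟩
  obtain ⟨K, hK⟩ := h δ hδ
  refine ⟨K.toNNReal, ?_⟩
  filter_upwards [hK K le_rfl] with n hn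
  refine (measure_mono ?_).trans (hn.trans hδε)
  intro ω hω
  exact not_le.2 hω

end HoldsWhp

/-! ### Uniform variables with marks -/

/-- The `(U i, V i)` are pairwise independent, `U i` is uniform on `[0,1]` and independent of
`V i ≥ 0`, and the first two moments of the `V i` are bounded. -/
structure IsMarkedUniform {Ω : Type*} [MeasurableSpace Ω] (μ : Measure Ω) (U V : ℕ → Ω → ℝ)
    (m q : ℝ) : Prop where
  measurable_loc : ∀ i, Measurable (U i)
  measurable_mark : ∀ i, Measurable (V i)
  map_loc : ∀ i, μ.map (U i) = uniformLaw
  indep : ∀ i, IndepFun (U i) (V i) μ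
  pairwise_indep : Pairwise fun i j => IndepFun (fun ω => (U i ω, V i ω)) (fun ω => (U j ω, V j ω)) μ
  memLp : ∀ i, MemLp (V i) 2 μ
  nonneg : ∀ i ω, 0 ≤ V i ω
  integral_le : ∀ i, ∫ ω, V i ω ∂μ ≤ m
  integral_sq_le : ∀ i, ∫ ω, V i ω ^ 2 ∂μ ≤ q

lemma isProbabilityMeasure_uniformLaw : IsProbabilityMeasure uniformLaw :=
  ⟨by simp [uniformLaw]⟩

attribute [instance] isProbabilityMeasure_uniformLaw

lemma uniformLaw_real_Iic_le {t : ℝ} (ht : 0 ≤ t) : uniformLaw.real (Iic t) ≤ t := by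
  rw [uniformLaw, measureReal_restrict_apply measurableSet_Iic]
  calc volume.real (Iic t ∩ Icc 0 1) ≤ volume.real (Icc 0 t) :=
        measureReal_mono (fun x hx => ⟨hx.2.1, hx.1⟩) (by simp)
    _ = t := by simp [ht]

lemma uniformLaw_real_Icc {a b : ℝ} (ha : 0 ≤ a) (hab : a ≤ b) (hb : b ≤ 1) :
    uniformLaw.real (Icc a b) = b - a := by
  rw [uniformLaw, measureReal_restrict_apply measurableSet_Icc,
    inter_eq_left.2 (Icc_subset_Icc ha hb)]
  simp [hab]

lemma uniformLaw_real_Iic {t : ℝ} (ht : 0 ≤ t) (ht1 : t ≤ 1) : uniformLaw.real (Iic t) = t := by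
  have : Iic t ∩ Icc (0 : ℝ) 1 = Icc 0 t := by
    ext x; simp only [mem_inter_iff, mem_Iic, mem_Icc]
    exact ⟨fun h => ⟨h.2.1, h.1⟩, fun h => ⟨h.2, h.1, h.2.trans ht1⟩⟩
  rw [uniformLaw, measureReal_restrict_apply measurableSet_Iic, this]
  simp [ht]

lemma sum_filter_mem_eq {Ω : Type*} {U V : ℕ → Ω → ℝ} (J : Set ℝ) [DecidablePred (· ∈ J)] (n : ℕ) (ω : Ω) :
    ∑ i : Fin n with U (i : Fin n) ω ∈ J, V i ω
      = (∑ i : Fin n, fun ω => J.indicator (1 : ℝ → ℝ) (U i ω) * V i ω) ω := by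
  rw [Finset.sum_apply, Finset.sum_filter]
  refine Finset.sum_congr rfl fun i _ => ?_
  by_cases hU : U i ω ∈ J <;> simp [hU]

section Marked

variable {Ω : Type*} [MeasurableSpace Ω] {μ : Measure Ω} {U V : ℕ → Ω → ℝ} {m q : ℝ}

namespace IsMarkedUniform

lemma bounds_nonneg (h : IsMarkedUniform μ U V m q) : 0 ≤ m ∧ 0 ≤ q :=
  ⟨(integral_nonneg (h.nonneg 0)).trans (h.integral_le 0),
    (integral_nonneg fun _ => sq_nonneg _).trans (h.integral_sq_le 0)⟩

lemma integral_indicator_mul (h : IsMarkedUniform μ U V m q) {J : Set ℝ} (hJ : MeasurableSet J)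
    {φ : ℝ → ℝ} (hφ : Measurable φ) (i : ℕ) :
    ∫ ω, J.indicator 1 (U i ω) * φ (V i ω) ∂μ = uniformLaw.real J * ∫ ω, φ (V i ω) ∂μ := by
  have hI : Measurable (J.indicator (1 : ℝ → ℝ)) := measurable_one.indicator hJ
  have h1 : IndepFun (fun ω => J.indicator (1 : ℝ → ℝ) (U i ω)) (fun ω => φ (V i ω)) μ :=
    (h.indep i).comp hI hφ
  have := h1.integral_mul_eq_mul_integral (hI.comp (h.measurable_loc i)).aestronglyMeasurable
    (hφ.comp (h.measurable_mark i)).aestronglyMeasurable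
  simp only [Pi.mul_apply] at this
  rw [this, ← h.map_loc i, ← integral_indicator_one hJ,
    integral_map (h.measurable_loc i).aemeasurable hI.aestronglyMeasurable]

lemma memLp_indicator_mul (h : IsMarkedUniform μ U V m q) {J : Set ℝ} (hJ : MeasurableSet J)
    (i : ℕ) : MemLp (fun ω => J.indicator 1 (U i ω) * V i ω) 2 μ := by
  have hI : Measurable (J.indicator (1 : ℝ → ℝ)) := measurable_one.indicator hJ
  refine (h.memLp i).mono
    ((hI.comp (h.measurable_loc i)).mul (h.measurable_mark i)).aestronglyMeasurable
    (ae_of_all _ fun ω => ?_)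
  by_cases hU : U i ω ∈ J <;> simp [hU]

variable [IsProbabilityMeasure μ]

lemma integral_sum_eq (h : IsMarkedUniform μ U V m q) {J : Set ℝ} [DecidablePred (· ∈ J)]
    (hJ : MeasurableSet J) (n : ℕ) :
    ∫ ω, ∑ i : Fin n with U (i : Fin n) ω ∈ J, V i ω ∂μ
      = uniformLaw.real J * ∑ i : Fin n, ∫ ω, V i ω ∂μ := by
  simp_rw [sum_filter_mem_eq, Finset.sum_apply]
  rw [integral_finsetSum _ fun (i : Fin n) _ => (h.memLp_indicator_mul hJ i).integrable one_le_two,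
    Finset.mul_sum]
  exact Finset.sum_congr rfl fun i _ => h.integral_indicator_mul hJ measurable_id i

lemma variance_sum_le (h : IsMarkedUniform μ U V m q) {J : Set ℝ} (hJ : MeasurableSet J) (n : ℕ) :
    Var[∑ i : Fin n, fun ω => J.indicator (1 : ℝ → ℝ) (U i ω) * V i ω; μ]
      ≤ n * uniformLaw.real J * q := by
  have hI : Measurable (J.indicator (1 : ℝ → ℝ)) := measurable_one.indicator hJ
  rw [IndepFun.variance_sum (X := fun (i : Fin n) ω => J.indicator (1 : ℝ → ℝ) (U i ω) * V i ω)
    (fun i _ => h.memLp_indicator_mul hJ i)]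
  · calc _ ≤ ∑ i : Fin n, uniformLaw.real J * q := by
          refine Finset.sum_le_sum fun i _ => ?_
          refine (variance_le_expectation_sq (h.memLp_indicator_mul hJ i).1).trans ?_
          have e : ∀ ω, ((fun ω => J.indicator (1 : ℝ → ℝ) (U i ω) * V i ω) ^ 2) ω
              = J.indicator 1 (U i ω) * V i ω ^ 2 := by
            intro ω
            by_cases hU : U i ω ∈ J <;> simp [hU]
          simp_rw [e]
          rw [h.integral_indicator_mul hJ (φ := fun v => v ^ 2) (by fun_prop) i]
          exact mul_le_mul_of_nonneg_left (h.integral_sq_le i) measureReal_nonneg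
      _ = _ := by simp; ring
  · intro i _ j _ hij
    exact (h.pairwise_indep (fun e => hij (Fin.ext e))).comp
      (φ := fun p => J.indicator (1 : ℝ → ℝ) p.1 * p.2)
      (ψ := fun p => J.indicator (1 : ℝ → ℝ) p.1 * p.2)
      ((hI.comp measurable_fst).mul measurable_snd) ((hI.comp measurable_fst).mul measurable_snd)

/-- Chebyshev's inequality for the sum of the marks of the points in `J`. -/
lemma measure_le_abs_sub_integral (h : IsMarkedUniform μ U V m q) {J : Set ℝ}
    [DecidablePred (· ∈ J)] (hJ : MeasurableSet J) (n : ℕ) {c : ℝ} (hc : 0 < c) :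
    μ {ω | c ≤ |∑ i : Fin n with U (i : Fin n) ω ∈ J, V i ω
        - ∫ ω, ∑ i : Fin n with U (i : Fin n) ω ∈ J, V i ω ∂μ|}
      ≤ ENNReal.ofReal (n * uniformLaw.real J * q / c ^ 2) := by
  simp_rw [sum_filter_mem_eq]
  refine (meas_ge_le_variance_div_sq (memLp_finsetSum' _ fun (i : Fin n) _ => h.memLp_indicator_mul hJ i)
    hc).trans (ENNReal.ofReal_le_ofReal ?_)
  gcongr
  exact h.variance_sum_le hJ n

lemma tsum_ofReal_mul_half_pow {c : ℝ} (hc : 0 ≤ c) :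
    ∑' k : ℕ, ENNReal.ofReal (c * (1 / 2) ^ k) = ENNReal.ofReal (2 * c) := by
  rw [← ENNReal.ofReal_tsum_of_nonneg (fun k => by positivity)
    (summable_geometric_two.mul_left c), tsum_mul_left, tsum_geometric_two, mul_comm]

/-- The sums of the marks over the initial intervals are at most of the order of their means,
uniformly over the intervals. -/
lemma holdsWhp_sum_le (h : IsMarkedUniform μ U V m q) :
    HoldsWhp μ fun K n ω => ∀ t ∈ Icc (0 : ℝ) 1,
      ∑ i : Fin n with U (i : Fin n) ω ≤ t, V i ω ≤ K * (n * t + 1) := by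
  refine HoldsWhp.of_mono (fun K K' n ω hKK' hP t ht => (hP t ht).trans (by
    have := ht.1; gcongr)) fun δ hδ => ?_
  obtain ⟨hm, hq⟩ := h.bounds_nonneg
  -- Chosen so that the failure probabilities `q / c ^ 2 * (1/2) ^ k` sum to at most `δ`.
  set c := max 1 (2 * q / δ) with hc
  have hc1 : 1 ≤ c := le_max_left _ _
  have hc2 : 2 * q / c ^ 2 ≤ δ := by
    have h1 : 2 * q / δ ≤ c := le_max_right _ _
    rw [div_le_iff₀ hδ] at h1
    rw [div_le_iff₀ (by positivity)]
    nlinarith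
  refine ⟨2 * (m + c), ?_⟩
  filter_upwards [eventually_ge_atTop 1] with n hn
  have hn0 : (0 : ℝ) < n := by exact_mod_cast hn
  set S : ℝ → Ω → ℝ := fun t ω => ∑ i : Fin n with U (i : Fin n) ω ≤ t, V i ω with hS
  have Smono : ∀ s t ω, s ≤ t → S s ω ≤ S t ω := fun s t ω hst =>
    Finset.sum_le_sum_of_subset_of_nonneg
      (Finset.monotone_filter_right _ fun i _ hi => le_trans hi hst) fun i _ _ => h.nonneg i ω
  -- Since `S` is monotone in `t`, it suffices to control the lengths `2 ^ k / n`; passing to the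
  -- next one costs the factor `2`. All `k` are allowed, including lengths beyond `1`, where the
  -- bound on the uniform law remains valid.
  have hsub : {ω | ¬ ∀ t ∈ Icc (0 : ℝ) 1, S t ω ≤ 2 * (m + c) * (n * t + 1)}
      ⊆ ⋃ k : ℕ, {ω | 2 ^ k * c ≤ |S (2 ^ k / n) ω - ∫ ω, S (2 ^ k / n) ω ∂μ|} := by
    intro ω hω
    by_contra hcon
    simp only [mem_iUnion, mem_ofPred_eq, not_exists, not_le] at hcon
    have key : ∀ k : ℕ, S (2 ^ k / n) ω ≤ 2 ^ k * (m + c) := by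
      intro k
      have hint : ∫ ω, S (2 ^ k / n) ω ∂μ ≤ 2 ^ k * m := by
        have e := h.integral_sum_eq (J := Iic (2 ^ k / (n : ℝ))) measurableSet_Iic n
        simp only [mem_Iic] at e
        rw [hS, e]
        calc uniformLaw.real (Iic (2 ^ k / (n : ℝ))) * ∑ i : Fin n, ∫ ω, V i ω ∂μ
            ≤ (2 ^ k / n) * ∑ i : Fin n, m := by
              gcongr
              · exact Finset.sum_nonneg fun i _ => integral_nonneg (h.nonneg i)
              · exact uniformLaw_real_Iic_le (by positivity)
              · exact h.integral_le _
          _ = 2 ^ k * m := by simp; field_simp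
      have := (abs_lt.1 (hcon k)).2
      linarith
    refine hω fun t ht => ?_
    have hmc : 0 ≤ m + c := by linarith
    rcases lt_or_ge ((n : ℝ) * t) 1 with h1 | h1
    · calc S t ω ≤ S (2 ^ 0 / n) ω := Smono _ _ _ (by
            rw [pow_zero, le_div_iff₀ hn0, mul_comm]; exact h1.le)
        _ ≤ 2 ^ 0 * (m + c) := key 0
        _ ≤ _ := by
          have : 0 ≤ (n : ℝ) * t := mul_nonneg hn0.le ht.1
          nlinarith
    · obtain ⟨k, hk, hk'⟩ := exists_nat_pow_near h1 one_lt_two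
      calc S t ω ≤ S (2 ^ (k + 1) / n) ω := Smono _ _ _ (by
            rw [le_div_iff₀ hn0, mul_comm]; exact hk'.le)
        _ ≤ 2 ^ (k + 1) * (m + c) := key _
        _ = 2 * (m + c) * 2 ^ k := by ring
        _ ≤ 2 * (m + c) * (n * t + 1) := by gcongr; linarith
  calc _ ≤ _ := measure_mono hsub
    _ ≤ _ := measure_iUnion_le _
    _ ≤ ∑' k : ℕ, ENNReal.ofReal (q / c ^ 2 * (1 / 2) ^ k) := by
      refine ENNReal.tsum_le_tsum fun k => ?_
      have e := h.measure_le_abs_sub_integral (J := Iic (2 ^ k / (n : ℝ))) measurableSet_Iic n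
        (c := 2 ^ k * c) (by positivity)
      simp only [mem_Iic] at e
      refine e.trans (ENNReal.ofReal_le_ofReal ?_)
      calc _ ≤ n * (2 ^ k / n) * q / (2 ^ k * c) ^ 2 := by
            gcongr
            exact uniformLaw_real_Iic_le (by positivity)
        _ = _ := by rw [one_div_pow]; field_simp
    _ = ENNReal.ofReal (2 * (q / c ^ 2)) := tsum_ofReal_mul_half_pow (by positivity)
    _ ≤ _ := ENNReal.ofReal_le_ofReal (by rw [← mul_div_assoc]; exact hc2)

/-- Markov's inequality: the mean is at most `n * q`. -/
lemma holdsWhp_sum_sq_le (h : IsMarkedUniform μ U V m q) :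
    HoldsWhp μ fun K n ω => ∑ i : Fin n, V i ω ^ 2 ≤ K * n := by
  refine HoldsWhp.of_mono (fun K K' n ω hKK' hP => hP.trans (by gcongr)) fun δ hδ => ?_
  obtain ⟨hm, hq⟩ := h.bounds_nonneg
  set c := max 1 (q / δ) with hc
  have hc1 : 1 ≤ c := le_max_left _ _
  have hc2 : q / c ≤ δ := by
    have h1 : q / δ ≤ c := le_max_right _ _
    rw [div_le_iff₀ hδ] at h1
    rw [div_le_iff₀ (by positivity)]
    linarith
  refine ⟨c, ?_⟩
  filter_upwards [eventually_ge_atTop 1] with n hn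
  have hn0 : (0 : ℝ) < n := by exact_mod_cast hn
  have hint : Integrable (fun ω => ∑ i : Fin n, V i ω ^ 2) μ :=
    integrable_finsetSum _ fun i _ => (h.memLp i).integrable_sq
  have := mul_meas_ge_le_integral_of_nonneg
    (ae_of_all μ fun ω => Finset.sum_nonneg fun i _ => sq_nonneg (V (i : Fin n) ω)) hint (c * n)
  rw [integral_finsetSum _ fun (i : Fin n) _ => (h.memLp i).integrable_sq] at this
  have h2 : c * n * μ.real {ω | c * n ≤ ∑ i : Fin n, V i ω ^ 2} ≤ n * q := by
    refine this.trans ?_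
    calc _ ≤ ∑ i : Fin n, q := Finset.sum_le_sum fun i _ => h.integral_sq_le i
      _ = _ := by simp
  have h3 : μ.real {ω | c * n ≤ ∑ i : Fin n, V i ω ^ 2} ≤ δ := by
    refine le_trans ?_ hc2
    rw [le_div_iff₀ (by positivity)]
    have : n * (μ.real {ω | c * n ≤ ∑ i : Fin n, V i ω ^ 2} * c) ≤ n * q := by linarith
    exact le_of_mul_le_mul_left this hn0
  calc _ ≤ μ {ω | c * n ≤ ∑ i : Fin n, V i ω ^ 2} :=
        measure_mono fun ω hω => (not_le.1 hω).le
    _ = ENNReal.ofReal (μ.real _) := (ofReal_measureReal).symm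
    _ ≤ _ := ENNReal.ofReal_le_ofReal h3

/-- A set of positive length contains at least half of the expected number of points, up to a small
probability. -/
lemma measure_card_lt_le (h : IsMarkedUniform μ U (fun _ _ => 1) m q) {J : Set ℝ}
    [DecidablePred (· ∈ J)] (hJ : MeasurableSet J) {n : ℕ} {r : ℝ} (hr : 0 < r)
    (hn : n * uniformLaw.real J = r) :
    μ {ω | ((Finset.univ.filter fun i : Fin n => U i ω ∈ J).card : ℝ) < r / 2}
      ≤ ENNReal.ofReal (4 * q / r) := by
  have e := h.measure_le_abs_sub_integral hJ n (c := r / 2) (by positivity)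
  rw [h.integral_sum_eq hJ n] at e
  simp only [Finset.sum_const, nsmul_eq_mul, mul_one, integral_const, probReal_univ, smul_eq_mul,
    Finset.card_univ, Fintype.card_fin] at e
  rw [mul_comm _ (n : ℝ), hn] at e
  refine (measure_mono ?_).trans (e.trans (ENNReal.ofReal_le_ofReal (le_of_eq ?_)))
  · intro ω hω
    have hω' : ((Finset.univ.filter fun i : Fin n => U i ω ∈ J).card : ℝ) < r / 2 := hω
    simp only [mem_ofPred_eq]
    rw [abs_sub_comm]
    exact le_trans (by linarith) (le_abs_self _)
  · field_simp
    ring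

lemma holdsWhp_le_card (h : IsMarkedUniform μ U (fun _ _ => 1) m q) {J : Set ℝ}
    [DecidablePred (· ∈ J)] (hJ : MeasurableSet J) (hpos : 0 < uniformLaw.real J) :
    HoldsWhp μ fun K n ω => n ≤ K * (Finset.univ.filter fun i : Fin n => U i ω ∈ J).card := by
  refine HoldsWhp.of_mono (fun K K' n ω hKK' hP => hP.trans (by gcongr)) fun δ hδ => ?_
  refine ⟨2 / uniformLaw.real J, ?_⟩
  obtain ⟨N, hN⟩ := exists_nat_gt (4 * q / (uniformLaw.real J * δ))
  filter_upwards [eventually_ge_atTop 1, eventually_ge_atTop N] with n hn hnN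
  have hn0 : (0 : ℝ) < n := by exact_mod_cast hn
  have hN' : 4 * q / (uniformLaw.real J * δ) ≤ n := hN.le.trans (by exact_mod_cast hnN)
  refine (measure_mono ?_).trans ((h.measure_card_lt_le hJ (mul_pos hn0 hpos) rfl).trans
    (ENNReal.ofReal_le_ofReal ?_))
  · intro ω hω
    simp only [mem_ofPred_eq, not_le] at hω ⊢
    rw [div_mul_eq_mul_div, div_lt_iff₀ hpos] at hω
    linarith
  · rw [div_le_iff₀ (by positivity)] at hN' ⊢
    linarith

/-- The number of points in initial intervals of length at least a large multiple of `1/n` is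
at least a multiple of its expectation. -/
lemma exists_measure_initial_card_le (h : IsMarkedUniform μ U (fun _ _ => 1) m q) {δ : ℝ}
    (hδ : 0 < δ) : ∃ a : ℝ, 1 ≤ a ∧ ∀ n : ℕ, 1 ≤ n →
      μ {ω | ¬ ∀ t ≤ 1, a ≤ n * t →
        n * t ≤ 8 * (Finset.univ.filter fun i : Fin n => U i ω ≤ t / 2).card} ≤ ENNReal.ofReal δ := by
  obtain ⟨hm, hq⟩ := h.bounds_nonneg
  set α := max 1 (8 * q / δ) with hα
  have hα1 : 1 ≤ α := le_max_left _ _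
  have hα2 : 8 * q / α ≤ δ := by
    have h1 : 8 * q / δ ≤ α := le_max_right _ _
    rw [div_le_iff₀ hδ] at h1
    rw [div_le_iff₀ (by positivity)]
    linarith
  refine ⟨2 * α, by linarith, fun n hn => ?_⟩
  have hn0 : (0 : ℝ) < n := by exact_mod_cast hn
  have hsub : {ω | ¬ ∀ t ≤ 1, 2 * α ≤ n * t →
        n * t ≤ 8 * (Finset.univ.filter fun i : Fin n => U i ω ≤ t / 2).card}
      ⊆ ⋃ k : ℕ, {ω | α * 2 ^ k / n ≤ 1 ∧
        ((Finset.univ.filter fun i : Fin n => U i ω ≤ α * 2 ^ k / n).card : ℝ) < α * 2 ^ k / 2} := by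
    intro ω hω
    by_contra hcon
    simp only [mem_iUnion, mem_ofPred_eq, not_exists, not_and, not_lt] at hcon
    refine hω fun t ht hat => ?_
    have h1 : 1 ≤ n * t / (2 * α) := by rwa [le_div_iff₀ (by positivity), one_mul]
    -- This scale satisfies `α * 2 ^ k ≤ n * t / 2 < 2 * α * 2 ^ k`, so a count of at least `α * 2 ^
    -- k / 2` exceeds `n * t / 8`.
    obtain ⟨k, hk, hk'⟩ := exists_nat_pow_near h1 one_lt_two
    rw [le_div_iff₀ (by positivity)] at hk
    rw [div_lt_iff₀ (by positivity)] at hk'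
    have h2 : α * 2 ^ k / n ≤ t / 2 := by
      rw [div_le_iff₀ hn0]; linarith
    have h0 : 0 ≤ α * 2 ^ k / n := by positivity
    have h3 := hcon k (by linarith)
    have h4 : ((Finset.univ.filter fun i : Fin n => U i ω ≤ α * 2 ^ k / n).card : ℝ)
        ≤ (Finset.univ.filter fun i : Fin n => U i ω ≤ t / 2).card := by
      exact_mod_cast Finset.card_le_card
        (Finset.monotone_filter_right _ fun i _ hi => le_trans hi h2)
    rw [pow_succ] at hk'
    linarith
  calc _ ≤ _ := measure_mono hsub
    _ ≤ _ := measure_iUnion_le _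
    _ ≤ ∑' k : ℕ, ENNReal.ofReal (4 * q / α * (1 / 2) ^ k) := by
      refine ENNReal.tsum_le_tsum fun k => ?_
      by_cases hk : α * 2 ^ k / n ≤ 1
      · have e := h.measure_card_lt_le (J := Iic (α * 2 ^ k / (n : ℝ))) measurableSet_Iic (n := n)
          (r := α * 2 ^ k) (by positivity)
          (by rw [uniformLaw_real_Iic (by positivity) hk]; field_simp)
        simp only [mem_Iic] at e
        refine (measure_mono fun ω hω => hω.2).trans (e.trans (ENNReal.ofReal_le_ofReal (le_of_eq ?_)))
        rw [one_div_pow]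
        field_simp
      · simp [hk]
    _ = ENNReal.ofReal (2 * (4 * q / α)) := tsum_ofReal_mul_half_pow (by positivity)
    _ ≤ _ := ENNReal.ofReal_le_ofReal (by
      calc 2 * (4 * q / α) = 8 * q / α := by ring
        _ ≤ δ := hα2)

/-- Near the endpoint, two points are rarely close together. -/
lemma measure_close_pair_le (h : IsMarkedUniform μ U V m q) (n : ℕ) {b c : ℝ} (hb : 0 ≤ b)
    (hc : 0 ≤ c) :
    μ {ω | ∃ i j : Fin n, i ≠ j ∧ U j ω ≤ b ∧ |U i ω - U j ω| ≤ c}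
      ≤ ENNReal.ofReal (n ^ 2 * (b * (2 * c))) := by
  have pair : ∀ i j : Fin n, i ≠ j → μ {ω | U j ω ≤ b ∧ |U i ω - U j ω| ≤ c}
      ≤ ENNReal.ofReal (b * (2 * c)) := by
    intro i j hij
    have hind : IndepFun (U j) (U i) μ :=
      (h.pairwise_indep (fun e => hij (Fin.ext e.symm))).comp measurable_fst measurable_fst
    have hlaw := (indepFun_iff_map_prod_eq_prod_map_map (h.measurable_loc j).aemeasurable
      (h.measurable_loc i).aemeasurable).1 hind
    rw [h.map_loc, h.map_loc] at hlaw
    set E : Set (ℝ × ℝ) := {p | p.1 ≤ b ∧ |p.2 - p.1| ≤ c} with hE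
    have hEm : MeasurableSet E :=
      (measurableSet_le measurable_fst measurable_const).inter
        (measurableSet_le (f := fun p : ℝ × ℝ => |p.2 - p.1|) (by fun_prop) measurable_const)
    have e1 : μ {ω | U j ω ≤ b ∧ |U i ω - U j ω| ≤ c} = (uniformLaw.prod uniformLaw) E := by
      rw [← hlaw, Measure.map_apply ((h.measurable_loc j).prodMk (h.measurable_loc i)) hEm]
      rfl
    rw [e1, Measure.prod_apply hEm]
    calc ∫⁻ x, uniformLaw (Prod.mk x ⁻¹' E) ∂uniformLaw
        ≤ ∫⁻ x, (Iic b).indicator (fun _ => ENNReal.ofReal (2 * c)) x ∂uniformLaw := by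
          refine lintegral_mono fun x => ?_
          by_cases hx : x ≤ b
          · rw [indicator_of_mem (show x ∈ Iic b from hx)]
            calc uniformLaw (Prod.mk x ⁻¹' E) ≤ volume (Icc (x - c) (x + c)) := by
                  refine (Measure.restrict_apply_le _ _).trans (measure_mono ?_)
                  intro y hy
                  have := abs_le.1 hy.2
                  exact ⟨by linarith [this.1], by linarith [this.2]⟩
              _ = _ := by rw [Real.volume_Icc]; congr 1; ring
          · have : Prod.mk x ⁻¹' E = ∅ := by
              ext y; simp [hE, hx]
            simp [this]
      _ = ENNReal.ofReal (2 * c) * uniformLaw (Iic b) := by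
          rw [lintegral_indicator measurableSet_Iic, lintegral_const, Measure.restrict_apply_univ]
      _ ≤ ENNReal.ofReal (2 * c) * ENNReal.ofReal b := by
          gcongr
          rw [← ofReal_measureReal]
          exact ENNReal.ofReal_le_ofReal (uniformLaw_real_Iic_le hb)
      _ = _ := by rw [← ENNReal.ofReal_mul (by positivity), mul_comm]
  have hsub : {ω | ∃ i j : Fin n, i ≠ j ∧ U j ω ≤ b ∧ |U i ω - U j ω| ≤ c}
      ⊆ ⋃ p : Fin n × Fin n, {ω | p.1 ≠ p.2 ∧ U p.2 ω ≤ b ∧ |U p.1 ω - U p.2 ω| ≤ c} := by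
    rintro ω ⟨i, j, h⟩
    exact mem_iUnion.2 ⟨(i, j), h⟩
  calc _ ≤ _ := measure_mono hsub
    _ ≤ _ := measure_iUnion_fintype_le _ _
    _ ≤ ∑ p : Fin n × Fin n, ENNReal.ofReal (b * (2 * c)) := by
      refine Finset.sum_le_sum fun p _ => ?_
      by_cases hp : p.1 = p.2
      · simp [hp]
      · exact (measure_mono fun ω hω => hω.2).trans (pair _ _ hp)
    _ = _ := by
      rw [Finset.sum_const, nsmul_eq_mul, ENNReal.ofReal_mul (p := (n : ℝ) ^ 2) (by positivity),
        ENNReal.ofReal_pow (by positivity), ENNReal.ofReal_natCast]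
      simp [sq]

lemma holdsWhp_le_card_initial (h : IsMarkedUniform μ U (fun _ _ => 1) m q) :
    HoldsWhp μ fun K n ω => (∀ i : Fin n, U i ω ∈ Icc (0 : ℝ) 1) → ∀ j : Fin n,
      n * U j ω + 1 ≤ K * (Finset.univ.filter fun i : Fin n => U i ω ≤ U j ω).card := by
  refine HoldsWhp.of_mono (fun K K' n ω hKK' hP hU j => (hP hU j).trans (by gcongr)) fun δ hδ => ?_
  obtain ⟨a, ha, H⟩ := h.exists_measure_initial_card_le hδ
  -- Point `j` counts itself, so the count is at least one. This suffices when `n * U j < a`;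
  -- otherwise `8` comes from the initial count and `1` from the additive term.
  refine ⟨a + 9, ?_⟩
  filter_upwards [eventually_ge_atTop 1] with n hn
  refine (measure_mono ?_).trans (H n hn)
  intro ω hω hgood
  refine hω fun hU j => ?_
  have hone : (1 : ℝ) ≤ (Finset.univ.filter fun i : Fin n => U i ω ≤ U j ω).card := by
    exact_mod_cast Finset.card_pos.2 ⟨j, by simp⟩
  rcases lt_or_ge ((n : ℝ) * U j ω) a with h1 | h1
  · nlinarith
  · have h2 := hgood (U j ω) (hU j).2 h1
    have h3 : ((Finset.univ.filter fun i : Fin n => U i ω ≤ U j ω / 2).card : ℝ)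
        ≤ (Finset.univ.filter fun i : Fin n => U i ω ≤ U j ω).card := by
      exact_mod_cast Finset.card_le_card (Finset.monotone_filter_right _ fun i _ hi =>
        le_trans hi (by linarith [(hU j).1]))
    nlinarith

/-- If `n * τ ≥ a`, at least `n * τ / 8` points lie below `τ / 2` and each contributes at least `(τ
/ 2) ^ 2`. If `n * τ < a`, one point to the left of `τ` is enough, because points this close to `0`
are separated by a multiple of `1 / n` with high probability. -/
lemma holdsWhp_le_sum_sq_initial (h : IsMarkedUniform μ U (fun _ _ => 1) m q) :
    HoldsWhp μ fun K n ω => (∀ i : Fin n, U i ω ∈ Icc (0 : ℝ) 1) → ∀ i j : Fin n,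
      U i ω < U j ω → (n * U j ω + 1) * U j ω ^ 2
        ≤ K * ∑ i : Fin n, max (U j ω - U i ω) 0 ^ 2 := by
  refine HoldsWhp.of_mono (fun K K' n ω hKK' hP hU i j hij => (hP hU i j hij).trans (by gcongr)) fun δ hδ => ?_
  obtain ⟨a, ha, H⟩ := h.exists_measure_initial_card_le (half_pos hδ)
  -- Makes the close-pair bound `n ^ 2 * (a / n) * (2 * η * a / n)` equal to `δ / 2`.
  set η := δ / (4 * a ^ 2) with hη
  have hη0 : 0 < η := by positivity
  refine ⟨64 + (a + 1) / η ^ 2, ?_⟩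
  filter_upwards [eventually_ge_atTop 1] with n hn
  have hn0 : (0 : ℝ) < n := by exact_mod_cast hn
  have hpair := h.measure_close_pair_le n (b := a / n) (c := η * (a / n)) (by positivity)
    (by positivity)
  have e : (n : ℝ) ^ 2 * (a / n * (2 * (η * (a / n)))) = δ / 2 := by
    rw [hη]; field_simp; norm_num
  rw [e] at hpair
  refine (measure_mono (t := {ω | ¬ ∀ t ≤ 1, a ≤ n * t →
        n * t ≤ 8 * (Finset.univ.filter fun i : Fin n => U i ω ≤ t / 2).card} ∪
      {ω | ∃ i j : Fin n, i ≠ j ∧ U j ω ≤ a / n ∧ |U i ω - U j ω| ≤ η * (a / n)}) ?_).trans ?_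
  · intro ω hω
    by_contra hcon
    simp only [mem_union, mem_ofPred_eq, not_or, not_not] at hcon
    obtain ⟨hgood, hsep⟩ := hcon
    refine hω fun hU i j hij => ?_
    set τ := U j ω with hτ
    have hτ0 : 0 < τ := (hU i).1.trans_lt hij
    set S := ∑ i : Fin n, max (τ - U i ω) 0 ^ 2 with hS
    have hS0 : 0 ≤ S := Finset.sum_nonneg fun i _ => sq_nonneg _
    rcases lt_or_ge ((n : ℝ) * τ) a with h1 | h1
    · have h2 : η * (a / n) < τ - U i ω := by
        by_contra! hle
        refine hsep ⟨i, j, fun e => by simp [e, hτ] at hij, ?_, ?_⟩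
        · rw [le_div_iff₀ hn0, mul_comm]; exact h1.le
        · rw [abs_sub_comm, abs_of_pos (by linarith)]; exact hle
      have h3 : η * τ ≤ τ - U i ω := by
        refine le_trans ?_ h2.le
        gcongr
        rw [le_div_iff₀ hn0, mul_comm]; exact h1.le
      have h4 : (η * τ) ^ 2 ≤ S := by
        refine le_trans ?_ (Finset.single_le_sum (f := fun i : Fin n => max (τ - U i ω) 0 ^ 2)
          (fun i _ => sq_nonneg _) (Finset.mem_univ i))
        gcongr
        exact h3.trans (le_max_left _ _)
      calc (n * τ + 1) * τ ^ 2 ≤ (a + 1) * τ ^ 2 := by gcongr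
        _ = (a + 1) / η ^ 2 * (η * τ) ^ 2 := by field_simp
        _ ≤ (a + 1) / η ^ 2 * S := by gcongr
        _ ≤ _ := by gcongr; linarith
    · have h2 := hgood τ (hU j).2 h1
      have h4 : (Finset.univ.filter fun i : Fin n => U i ω ≤ τ / 2).card * (τ / 2) ^ 2 ≤ S := by
        rw [← nsmul_eq_mul, ← Finset.sum_const, Finset.sum_filter]
        refine Finset.sum_le_sum fun k _ => ?_
        split_ifs with hk
        · gcongr
          exact le_trans (by linarith) (le_max_left _ _)
        · positivity
      have h5 : (n * τ + 1) * τ ^ 2 ≤ 64 * S := by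
        have : n * τ * τ ^ 2 ≤ 8 * (Finset.univ.filter fun i : Fin n => U i ω ≤ τ / 2).card * τ ^ 2 := by
          gcongr
        nlinarith [sq_nonneg τ]
      refine h5.trans ?_
      gcongr
      have : 0 < (a + 1) / η ^ 2 := by positivity
      linarith
  · calc _ ≤ _ := measure_union_le _ _
      _ ≤ ENNReal.ofReal (δ / 2) + ENNReal.ofReal (δ / 2) := add_le_add (H n hn) hpair
      _ = _ := by rw [← ENNReal.ofReal_add (by positivity) (by positivity), add_halves]

end IsMarkedUniform

end Marked

/-! ### Supremum norm bounds for given data -/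

/-- The canonical form reduces the supremum to the design points; the primed hypotheses serve the
reflected problem, which gives the upper bound. -/
lemma supNorm_le_of_isotonic {n : ℕ} [NeZero n] {x w T : Fin n → ℝ} {f : ℝ → ℝ}
    (hf : IsLeastSquaresFit isotonicModel x w f) (hcan : IsCanonicalStep x f)
    (hx : ∀ i, x i ∈ Icc (0 : ℝ) 1) (hw : ∀ i, |w i| ≤ T i) {K : ℝ} (hK : 0 ≤ K)
    (h1 : ∀ t ∈ Icc (0 : ℝ) 1, ∑ i with x i ≤ t, T i ≤ K * (n * t + 1))
    (h1' : ∀ t ∈ Icc (0 : ℝ) 1, ∑ i with 1 - x i ≤ t, T i ≤ K * (n * t + 1))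
    (h2 : ∀ j, n * x j + 1 ≤ K * (Finset.univ.filter fun i => x i ≤ x j).card)
    (h2' : ∀ j, n * (1 - x j) + 1 ≤ K * (Finset.univ.filter fun i => 1 - x i ≤ 1 - x j).card) :
    supNorm f ≤ ENNReal.ofReal (K * K) := by
  refine supNorm_le_of_forall fun t ht => ?_
  obtain ⟨i, hi⟩ := hcan.exists_eq ht
  rw [hi, abs_le]
  constructor
  · exact hf.neg_div_le_of_isotonic hx hK
      (fun t ht => (Finset.sum_le_sum fun i _ => hw i).trans (h1 t ht)) h2 i
  · have := hf.reflect_isotonic.neg_div_le_of_isotonic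
      (fun i => ⟨by linarith [(hx i).2], by linarith [(hx i).1]⟩) hK
      (fun t ht => (Finset.sum_le_sum fun i _ => (by rw [abs_neg]; exact hw i)).trans (h1' t ht))
      h2' i
    simp only [sub_sub_cancel] at this
    linarith

/-- If the sum of the squares `v i ^ 2` is at most of order `n`, then one of the `v i` is
bounded, for `i` in a set of cardinality of order `n`. -/
lemma exists_abs_le_of_sum_sq_le {n : ℕ} [NeZero n] {v : Fin n → ℝ} {s : Finset (Fin n)} {K C : ℝ}
    (hK : 0 ≤ K) (hC : 0 ≤ C) (hv : ∑ i, v i ^ 2 ≤ C * n) (hs : n ≤ K * s.card) :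
    ∃ i ∈ s, |v i| ≤ C * K + 1 := by
  by_contra! hcon
  have hn : (0 : ℝ) < n := by exact_mod_cast NeZero.pos n
  have hs0 : (0 : ℝ) < s.card := by
    by_contra! h
    nlinarith
  have h0 : 0 ≤ C * K := by positivity
  have : (C * K + 1) * s.card ≤ ∑ i, v i ^ 2 := by
    calc (C * K + 1) * s.card = ∑ i ∈ s, (C * K + 1) := by
          rw [Finset.sum_const, nsmul_eq_mul, mul_comm]
      _ ≤ ∑ i ∈ s, v i ^ 2 := Finset.sum_le_sum fun i hi => by
          rw [← sq_abs]; nlinarith [hcon i hi]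
      _ ≤ _ := Finset.sum_le_sum_of_subset_of_nonneg (Finset.subset_univ _)
          fun i _ _ => sq_nonneg _
  nlinarith [mul_le_mul_of_nonneg_left hs hC]

lemma supNorm_le_of_convex {n : ℕ} [NeZero n] {x w T : Fin n → ℝ} {f : ℝ → ℝ}
    (hf : IsLeastSquaresFit convexModel x w f) (hcan : IsCanonicalPiecewiseLinear x f)
    (hx : ∀ i, x i ∈ Icc (0 : ℝ) 1) (hw : ∀ i, |w i| ≤ T i) {K : ℝ} (hK : 0 ≤ K)
    (hT : ∑ i, T i ^ 2 ≤ K * n)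
    (hJ₁ : n ≤ K * (Finset.univ.filter fun i => x i ∈ Icc (0 : ℝ) (1 / 8)).card)
    (hJ₂ : n ≤ K * (Finset.univ.filter fun i => x i ∈ Icc (3 / 8 : ℝ) (1 / 2)).card)
    (hJ₃ : n ≤ K * (Finset.univ.filter fun i => x i ∈ Icc (1 / 2 : ℝ) (5 / 8)).card)
    (hJ₄ : n ≤ K * (Finset.univ.filter fun i => x i ∈ Icc (7 / 8 : ℝ) 1).card)
    (h1 : ∀ t ∈ Icc (0 : ℝ) 1, ∑ i with x i ≤ t, T i ≤ K * (n * t + 1))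
    (h1' : ∀ t ∈ Icc (0 : ℝ) 1, ∑ i with 1 - x i ≤ t, T i ≤ K * (n * t + 1))
    (h2 : ∀ t ∈ Icc (0 : ℝ) 1, ((Finset.univ.filter fun i => x i ≤ t).card : ℝ) ≤ K * (n * t + 1))
    (h2' : ∀ t ∈ Icc (0 : ℝ) 1,
      ((Finset.univ.filter fun i => 1 - x i ≤ t).card : ℝ) ≤ K * (n * t + 1))
    (h3 : ∀ i j, x i < x j → (n * x j + 1) * x j ^ 2 ≤ K * ∑ i, max (x j - x i) 0 ^ 2)
    (h3' : ∀ i j, 1 - x i < 1 - x j →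
      (n * (1 - x j) + 1) * (1 - x j) ^ 2 ≤ K * ∑ i, max ((1 - x j) - (1 - x i)) 0 ^ 2) :
    supNorm f ≤ ENNReal.ofReal
      (3 * (8 * (4 * K * K + 1)) + K * K * (2 + 8 * (4 * K * K + 1))) := by
  have hconv : ConvexOn ℝ (Icc 0 1) f := hf.1
  -- The bound of `exists_abs_le_of_sum_sq_le` with `C = 4 * K`, the constant in `hsq`.
  set M := 4 * K * K + 1 with hM
  have hM0 : 0 ≤ M := by positivity
  have hKM : 0 ≤ K * K * (2 + 8 * M) := by positivity
  have hsq : ∑ i, f (x i) ^ 2 ≤ 4 * K * n := by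
    have h : ∑ i, w i ^ 2 ≤ ∑ i, T i ^ 2 := Finset.sum_le_sum fun i _ => by
      rw [← sq_abs]; gcongr; exact hw i
    have := hf.sum_sq_le (convexOn_const 0 (convex_Icc _ _))
    linarith
  have h4K : 0 ≤ 4 * K := by positivity
  obtain ⟨i₁, m₁, b₁⟩ := exists_abs_le_of_sum_sq_le hK h4K hsq hJ₁
  obtain ⟨i₂, m₂, b₂⟩ := exists_abs_le_of_sum_sq_le hK h4K hsq hJ₂
  obtain ⟨i₃, m₃, b₃⟩ := exists_abs_le_of_sum_sq_le hK h4K hsq hJ₃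
  obtain ⟨i₄, m₄, b₄⟩ := exists_abs_le_of_sum_sq_le hK h4K hsq hJ₄
  simp only [Finset.mem_filter, Finset.mem_univ, true_and] at m₁ m₂ m₃ m₄
  have hlow : ∀ t ∈ Icc (0 : ℝ) 1, -(8 * M) ≤ f t := fun t ht =>
    hconv.neg_le_of_bounded_at m₁ m₂ m₃ m₄ b₁ b₂ b₃ b₄ ht
  have hup : ∀ t ∈ Icc (1 / 8 : ℝ) (7 / 8), f t ≤ 8 * M := fun t ht =>
    (hconv.le_of_bounded_at m₁ m₄ b₁ b₄ ht).trans (by linarith)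
  have hlt : x i₁ < x i₄ := by linarith [m₁.2, m₄.1]
  have hzero := hf.apply_zero_le_of_convex hcan hx hK (by positivity) hlow hup hlt
    (by linarith [m₄.1]) (fun t ht => (Finset.sum_le_sum fun i _ => hw i).trans (h1 t ht)) h2 h3
  have hone := hf.reflect_convex.apply_zero_le_of_convex hcan.reflect
    (fun i => ⟨by linarith [(hx i).2], by linarith [(hx i).1]⟩) hK (M := 8 * M) (by positivity)
    (fun t ht => hlow (1 - t) ⟨by linarith [ht.2], by linarith [ht.1]⟩)
    (fun t ht => hup (1 - t) ⟨by linarith [ht.2], by linarith [ht.1]⟩)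
    (i₀ := i₄) (j₀ := i₁) (by linarith) (by linarith [m₁.2])
    (fun t ht => (Finset.sum_le_sum fun i _ => hw i).trans (h1' t ht)) h2' h3'
  rw [sub_zero] at hone
  refine supNorm_le_of_forall fun t ht => abs_le.2 ⟨?_, ?_⟩
  · linarith [hlow t ht]
  · exact (hconv.le_max_of_mem_Icc (by simp) (by simp) ht).trans (max_le hzero hone)

/-! ### The marked uniform variables of the regression model -/

/-- Pairs formed from two independent sequences, each of them pairwise independent, are pairwise
independent. -/
lemma pairwise_indepFun_prodMk {Ω α β : Type*} [MeasurableSpace Ω] [MeasurableSpace α]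
    [MeasurableSpace β] {μ : Measure Ω} [IsProbabilityMeasure μ] {A : ℕ → Ω → α} {C : ℕ → Ω → β}
    (hA : ∀ i, Measurable (A i)) (hC : ∀ i, Measurable (C i))
    (hAp : Pairwise fun i j => IndepFun (A i) (A j) μ)
    (hCp : Pairwise fun i j => IndepFun (C i) (C j) μ)
    (hAC : IndepFun (fun ω i => A i ω) (fun ω i => C i ω) μ) :
    Pairwise fun i j => IndepFun (fun ω => (A i ω, C i ω)) (fun ω => (A j ω, C j ω)) μ := by
  intro i j hij
  rw [IndepFun_iff_Indep]
  have hgen : ∀ k, MeasurableSpace.comap (fun ω => (A k ω, C k ω)) Prod.instMeasurableSpace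
      = MeasurableSpace.generateFrom (preimage (fun ω => (A k ω, C k ω)) ''
        image2 (fun s t => s ×ˢ t) {s : Set α | MeasurableSet s} {t : Set β | MeasurableSet t}) := by
    intro k
    rw [← MeasurableSpace.comap_generateFrom, generateFrom_prod]
  -- Measurable rectangles form a generating π-system. On them the probability factors first between
  -- the two sequences and then within each.
  refine IndepSets.indep ((hA i).prodMk (hC i)).comap_le ((hA j).prodMk (hC j)).comap_le
    (isPiSystem_prod.comap _) (isPiSystem_prod.comap _) (hgen i) (hgen j) ?_
  rw [IndepSets_iff]
  rintro _ _ ⟨_, ⟨s, hs, t, ht, rfl⟩, rfl⟩ ⟨_, ⟨s', hs', t', ht', rfl⟩, rfl⟩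
  have hs : MeasurableSet s := hs
  have ht : MeasurableSet t := ht
  have hs' : MeasurableSet s' := hs'
  have ht' : MeasurableSet t' := ht'
  have h2 := hAC.measure_inter_preimage_eq_mul
    ((fun a : ℕ → α => a i) ⁻¹' s ∩ (fun a : ℕ → α => a j) ⁻¹' s')
    ((fun c : ℕ → β => c i) ⁻¹' t ∩ (fun c : ℕ → β => c j) ⁻¹' t')
    ((measurable_pi_apply i hs).inter (measurable_pi_apply j hs'))
    ((measurable_pi_apply i ht).inter (measurable_pi_apply j ht'))
  have h1 : ∀ k (u : Set α) (v : Set β), MeasurableSet u → MeasurableSet v →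
      μ ((A k ⁻¹' u) ∩ (C k ⁻¹' v)) = μ (A k ⁻¹' u) * μ (C k ⁻¹' v) := fun k u v hu hv =>
    (hAC.comp (measurable_pi_apply k) (measurable_pi_apply k)).measure_inter_preimage_eq_mul _ _ hu hv
  calc μ ((fun ω => (A i ω, C i ω)) ⁻¹' s ×ˢ t ∩ (fun ω => (A j ω, C j ω)) ⁻¹' s' ×ˢ t')
      = μ ((A i ⁻¹' s ∩ A j ⁻¹' s') ∩ (C i ⁻¹' t ∩ C j ⁻¹' t')) := by
        congr 1; ext ω; simp only [mem_inter_iff, mem_preimage, mem_prod]; tauto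
    _ = μ (A i ⁻¹' s ∩ A j ⁻¹' s') * μ (C i ⁻¹' t ∩ C j ⁻¹' t') := h2
    _ = (μ (A i ⁻¹' s) * μ (C i ⁻¹' t)) * (μ (A j ⁻¹' s') * μ (C j ⁻¹' t')) := by
        rw [(hAp hij).measure_inter_preimage_eq_mul _ _ hs hs',
          (hCp hij).measure_inter_preimage_eq_mul _ _ ht ht']
        ring
    _ = _ := by
        rw [← h1 i s t hs ht, ← h1 j s' t' hs' ht']
        rfl

lemma map_one_sub_uniformLaw : uniformLaw.map (fun t => 1 - t) = uniformLaw := by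
  have h := (volume.measurePreserving_sub_left (1 : ℝ)).restrict_preimage
    (measurableSet_Icc (a := (0 : ℝ)) (b := 1))
  have e : (fun t : ℝ => 1 - t) ⁻¹' Icc 0 1 = Icc 0 1 := by
    ext t; simp only [mem_preimage, mem_Icc]; constructor <;> rintro ⟨_, _⟩ <;> constructor <;> linarith
  rw [e] at h
  exact h.map_eq

lemma IsMarkedUniform.reflect {Ω : Type*} [MeasurableSpace Ω] {μ : Measure Ω} {U V : ℕ → Ω → ℝ}
    {m q : ℝ} (h : IsMarkedUniform μ U V m q) :
    IsMarkedUniform μ (fun i ω => 1 - U i ω) V m q where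
  measurable_loc i := (h.measurable_loc i).const_sub 1
  measurable_mark := h.measurable_mark
  map_loc i := by
    have := Measure.map_map (μ := μ) (f := U i) (g := fun t => 1 - t) (by fun_prop)
      (h.measurable_loc i)
    rw [h.map_loc, map_one_sub_uniformLaw] at this
    exact this.symm
  indep i := (h.indep i).comp (φ := fun t => 1 - t) (ψ := id) (by fun_prop) measurable_id
  pairwise_indep i j hij := (h.pairwise_indep hij).comp
    (φ := fun p : ℝ × ℝ => (1 - p.1, p.2)) (ψ := fun p : ℝ × ℝ => (1 - p.1, p.2))
    (by fun_prop) (by fun_prop)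
  memLp := h.memLp
  nonneg := h.nonneg
  integral_le := h.integral_le
  integral_sq_le := h.integral_sq_le

/-- With unit marks, sums of marks become numbers of points. -/
lemma IsMarkedUniform.one {Ω : Type*} [MeasurableSpace Ω] {μ : Measure Ω} [IsProbabilityMeasure μ]
    {U V : ℕ → Ω → ℝ} {m q : ℝ} (h : IsMarkedUniform μ U V m q) :
    IsMarkedUniform μ U (fun _ _ => 1) 1 1 where
  measurable_loc := h.measurable_loc
  measurable_mark _ := measurable_const
  map_loc := h.map_loc
  indep i := indepFun_const_right _ _
  pairwise_indep i j hij := (h.pairwise_indep hij).comp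
    (φ := fun p : ℝ × ℝ => (p.1, (1 : ℝ))) (ψ := fun p : ℝ × ℝ => (p.1, (1 : ℝ)))
    (by fun_prop) (by fun_prop)
  memLp _ := memLp_const _
  nonneg _ _ := zero_le_one
  integral_le _ := by simp
  integral_sq_le _ := by simp

/-- A finite `L_{2,1}` norm bounds the second moment. -/
lemma memLp_two_of_lorentzNorm_lt_top {Ω : Type*} [MeasurableSpace Ω] {μ : Measure Ω} {ξ : Ω → ℝ}
    (hξ : Measurable ξ) (h : lorentzNorm 2 ξ μ < ∞) : MemLp ξ 2 μ := by
  set p : ℝ → ℝ≥0∞ := fun t => μ {ω | t < |ξ ω|} ^ (1 / 2 : ℝ) with hp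
  set L := lorentzNorm 2 ξ μ with hL
  have hpL : ∫⁻ t in Ioi (0 : ℝ), p t = L := rfl
  have hanti : Antitone p := fun s t hst =>
    ENNReal.rpow_le_rpow (measure_mono fun ω hω => lt_of_le_of_lt hst hω) (by norm_num)
  -- As `p` is nonincreasing, `t * p t` is at most its integral. Hence `t * P(|ξ| > t) = t * p t ^ 2
  -- ≤ L * p t`, whose integral is `L * L`.
  have hmarkov : ∀ t, 0 < t → ENNReal.ofReal t * p t ≤ L := by
    intro t ht
    calc ENNReal.ofReal t * p t = ∫⁻ _ in Ioc 0 t, p t := by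
          rw [setLIntegral_const, Real.volume_Ioc, sub_zero, mul_comm]
      _ ≤ ∫⁻ s in Ioc 0 t, p s := setLIntegral_mono hanti.measurable fun s hs => hanti hs.2
      _ ≤ ∫⁻ s in Ioi 0, p s := lintegral_mono_set fun s hs => hs.1
      _ = L := hpL
  have hsq : ∀ t, μ {ω | t < |ξ ω|} = p t * p t := by
    intro t
    rw [hp]
    simp only
    rw [← ENNReal.rpow_add_of_nonneg _ _ (by norm_num) (by norm_num)]
    norm_num
  have hlc := lintegral_rpow_eq_lintegral_meas_lt_mul μ (f := fun ω => |ξ ω|)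
    (ae_of_all _ fun ω => abs_nonneg _) hξ.abs.aemeasurable (p := 2) two_pos
  refine (memLp_two_iff_integrable_sq hξ.aestronglyMeasurable).2
    ⟨(hξ.pow_const 2).aestronglyMeasurable, ?_⟩
  have e : ∫⁻ ω, ‖ξ ω ^ 2‖ₑ ∂μ = ∫⁻ ω, ENNReal.ofReal (|ξ ω| ^ (2 : ℝ)) ∂μ := by
    refine lintegral_congr fun ω => ?_
    rw [← ofReal_norm, norm_pow, Real.norm_eq_abs]
    norm_num
  rw [HasFiniteIntegral, e, hlc]
  refine ENNReal.mul_lt_top ENNReal.ofReal_lt_top ?_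
  calc ∫⁻ t in Ioi (0 : ℝ), μ {a | t < |ξ a|} * ENNReal.ofReal (t ^ ((2 : ℝ) - 1))
      ≤ ∫⁻ t in Ioi (0 : ℝ), L * p t := by
        refine setLIntegral_mono (hanti.measurable.const_mul L) fun t ht => ?_
        rw [hsq]
        have : t ^ ((2 : ℝ) - 1) = t := by norm_num
        rw [this]
        calc p t * p t * ENNReal.ofReal t = (ENNReal.ofReal t * p t) * p t := by ring
          _ ≤ _ := by gcongr; exact hmarkov t ht
    _ = L * L := by rw [lintegral_const_mul _ hanti.measurable, hpL]
    _ < ∞ := ENNReal.mul_lt_top h h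

/-- The summands are treated as separate marks, so no independence between `V` and `V'` is required.
-/
lemma IsMarkedUniform.holdsWhp_sum_add_le {Ω : Type*} [MeasurableSpace Ω] {μ : Measure Ω}
    [IsProbabilityMeasure μ] {U V V' : ℕ → Ω → ℝ} {m q m' q' B : ℝ}
    (h : IsMarkedUniform μ U V m q) (h' : IsMarkedUniform μ U V' m' q') (hB : 0 ≤ B) :
    HoldsWhp μ fun K n ω => ∀ t ∈ Icc (0 : ℝ) 1,
      ∑ i : Fin n with U (i : Fin n) ω ≤ t, (B + V i ω + V' i ω) ≤ K * (n * t + 1) := by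
  refine ((h.one.holdsWhp_sum_le.and h.holdsWhp_sum_le).and h'.holdsWhp_sum_le).imp
    (fun K K' n ω hKK' hP t ht => (hP t ht).trans (by have := ht.1; gcongr))
    (fun K => (B + 2) * K) fun K hK => Eventually.of_forall fun n => ae_of_all _ fun ω hω t ht => ?_
  obtain ⟨⟨h1, h2⟩, h3⟩ := hω
  have e : ∀ i : Fin n, B + V i ω + V' i ω = B * 1 + V i ω + V' i ω := fun i => by ring
  simp_rw [e, Finset.sum_add_distrib, ← Finset.mul_sum]
  have := mul_le_mul_of_nonneg_left (h1 t ht) hB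
  have := h2 t ht
  have := h3 t ht
  linarith

lemma IsMarkedUniform.holdsWhp_sum_add_sq_le {Ω : Type*} [MeasurableSpace Ω] {μ : Measure Ω}
    [IsProbabilityMeasure μ] {U V V' : ℕ → Ω → ℝ} {m q m' q' B : ℝ}
    (h : IsMarkedUniform μ U V m q) (h' : IsMarkedUniform μ U V' m' q') :
    HoldsWhp μ fun K n ω => ∑ i : Fin n, (B + V i ω + V' i ω) ^ 2 ≤ K * n := by
  refine (h.holdsWhp_sum_sq_le.and h'.holdsWhp_sum_sq_le).imp
    (fun K K' n ω hKK' hP => hP.trans (by gcongr))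
    (fun K => 3 * B ^ 2 + 6 * K) fun K hK =>
      Eventually.of_forall fun n => ae_of_all _ fun ω hω => ?_
  calc ∑ i : Fin n, (B + V i ω + V' i ω) ^ 2
      ≤ ∑ i : Fin n, (3 * B ^ 2 + 3 * V i ω ^ 2 + 3 * V' i ω ^ 2) :=
        Finset.sum_le_sum fun i _ => by
          nlinarith [sq_nonneg (B - V i ω), sq_nonneg (B - V' i ω), sq_nonneg (V i ω - V' i ω)]
    _ = n * (3 * B ^ 2) + 3 * ∑ i : Fin n, V i ω ^ 2 + 3 * ∑ i : Fin n, V' i ω ^ 2 := by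
        simp_rw [Finset.sum_add_distrib, ← Finset.mul_sum]
        simp
        ring
    _ ≤ _ := by linarith [hω.1, hω.2]

/-! ### Stochastic boundedness from dominated responses -/

section Model

variable {Ω : Type*} [MeasurableSpace Ω] {μ : Measure Ω} [IsProbabilityMeasure μ]
  {X V V' : ℕ → Ω → ℝ} {m q m' q' B : ℝ}

lemma stochasticallyBounded_of_isotonic (h : IsMarkedUniform μ X V m q)
    (h' : IsMarkedUniform μ X V' m' q') (hB : 0 ≤ B) (hX : ∀ᵐ ω ∂μ, ∀ i, X i ω ∈ Icc (0 : ℝ) 1)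
    {f : ℕ → Ω → ℝ → ℝ}
    (hf : ∀ n, 1 ≤ n → ∀ᵐ ω ∂μ, ∃ w : Fin n → ℝ, (∀ i : Fin n, |w i| ≤ B + V i ω + V' i ω) ∧
      IsLeastSquaresFit isotonicModel (fun i : Fin n => X i ω) w (f n ω) ∧
      IsCanonicalStep (fun i : Fin n => X i ω) (f n ω)) :
    StochasticallyBounded μ (fun n ω => supNorm (f n ω)) := by
  refine HoldsWhp.stochasticallyBounded ((((h.holdsWhp_sum_add_le h' hB).and
    (h.reflect.holdsWhp_sum_add_le h'.reflect hB)).and (h.one.holdsWhp_le_card_initial.and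
    h.one.reflect.holdsWhp_le_card_initial)).imp
    (fun K K' n ω hKK' hP => hP.trans (ENNReal.ofReal_le_ofReal hKK')) (fun K => K * K)
    fun K hK => ?_)
  filter_upwards [eventually_ge_atTop 1] with n hn
  have : NeZero n := ⟨by omega⟩
  filter_upwards [hX, hf n hn] with ω hXω hfω hω
  obtain ⟨w, hw, hls, hcan⟩ := hfω
  obtain ⟨⟨h1, h1'⟩, h2, h2'⟩ := hω
  exact supNorm_le_of_isotonic hls hcan (fun i => hXω i) hw (by linarith) h1 h1'
    (h2 fun i => hXω i)
    (h2' fun i => ⟨by linarith [(hXω i).2], by linarith [(hXω i).1]⟩)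

lemma stochasticallyBounded_of_convex (h : IsMarkedUniform μ X V m q)
    (h' : IsMarkedUniform μ X V' m' q') (hB : 0 ≤ B) (hX : ∀ᵐ ω ∂μ, ∀ i, X i ω ∈ Icc (0 : ℝ) 1)
    {f : ℕ → Ω → ℝ → ℝ}
    (hf : ∀ n, 1 ≤ n → ∀ᵐ ω ∂μ, ∃ w : Fin n → ℝ, (∀ i : Fin n, |w i| ≤ B + V i ω + V' i ω) ∧
      IsLeastSquaresFit convexModel (fun i : Fin n => X i ω) w (f n ω) ∧
      IsCanonicalPiecewiseLinear (fun i : Fin n => X i ω) (f n ω)) :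
    StochasticallyBounded μ (fun n ω => supNorm (f n ω)) := by
  have hJ : ∀ a b : ℝ, 0 ≤ a → a < b → b ≤ 1 → HoldsWhp μ fun K n ω =>
      n ≤ K * (Finset.univ.filter fun i : Fin n => X i ω ∈ Icc a b).card := fun a b ha hab hb =>
    h.one.holdsWhp_le_card (J := Icc a b) measurableSet_Icc
      (by rw [uniformLaw_real_Icc ha hab.le hb]; exact sub_pos.2 hab)
  have H := (h.holdsWhp_sum_add_sq_le h' (B := B)).and <|
    (hJ 0 (1 / 8) (by norm_num) (by norm_num) (by norm_num)).and <|
    (hJ (3 / 8) (1 / 2) (by norm_num) (by norm_num) (by norm_num)).and <|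
    (hJ (1 / 2) (5 / 8) (by norm_num) (by norm_num) (by norm_num)).and <|
    (hJ (7 / 8) 1 (by norm_num) (by norm_num) (by norm_num)).and <|
    (h.holdsWhp_sum_add_le h' hB).and <| (h.reflect.holdsWhp_sum_add_le h'.reflect hB).and <|
    h.one.holdsWhp_sum_le.and <| h.one.reflect.holdsWhp_sum_le.and <|
    h.one.holdsWhp_le_sum_sq_initial.and h.one.reflect.holdsWhp_le_sum_sq_initial
  refine HoldsWhp.stochasticallyBounded (H.imp
    (fun K K' n ω hKK' hP => hP.trans (ENNReal.ofReal_le_ofReal hKK'))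
    (fun K => 3 * (8 * (4 * K * K + 1)) + K * K * (2 + 8 * (4 * K * K + 1))) fun K hK => ?_)
  filter_upwards [eventually_ge_atTop 1] with n hn
  have : NeZero n := ⟨by omega⟩
  filter_upwards [hX, hf n hn] with ω hXω hfω hω
  obtain ⟨w, hw, hls, hcan⟩ := hfω
  obtain ⟨hT, hJ₁, hJ₂, hJ₃, hJ₄, h1, h1', h2, h2', h3, h3'⟩ := hω
  simp only [Finset.sum_const, nsmul_eq_mul, mul_one] at h2 h2'
  exact supNorm_le_of_convex hls hcan (fun i => hXω i) hw (by linarith) hT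
    hJ₁ hJ₂ hJ₃ hJ₄ h1 h1' h2 h2'
    (h3 fun i => hXω i)
    (h3' fun i => ⟨by linarith [(hXω i).2], by linarith [(hXω i).1]⟩)

end Model

/-! ### The additive regression model -/

theorem mainTheorem7 {Ω : Type*} [MeasurableSpace Ω] (μ : Measure Ω) [IsProbabilityMeasure μ]
    (X Z Y ξ : ℕ → Ω → ℝ) (φ₀ : ℝ × ℝ → ℝ) (H : Set (ℝ → ℝ)) (env : ℝ → ℝ)
    -- the covariates are i.i.d. uniform on the unit square
    (hX : ∀ i, Measurable (X i)) (hZ : ∀ i, Measurable (Z i))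
    (hXZ_law : ∀ i, μ.map (fun ω => (X i ω, Z i ω)) = uniformLaw.prod uniformLaw)
    (hXZ_indep : iIndepFun (fun i ω => (X i ω, Z i ω)) μ)
    -- the errors are i.i.d., mean zero, with finite `L_{2,1}` norm
    (hξ : ∀ i, Measurable (ξ i))
    (hξ_ident : ∀ i, IdentDistrib (ξ i) (ξ 0) μ μ)
    (hξ_indep : iIndepFun ξ μ)
    (hξ_mean : ∫ ω, ξ 0 ω ∂μ = 0)
    (hξ_norm : lorentzNorm 2 (ξ 0) μ < ∞)
    -- the covariates and the errors are independent
    (hXZξ : IndepFun (fun ω i => (X i ω, Z i ω)) (fun ω i => ξ i ω) μ)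
    -- the regression model, with a bounded regression function
    (hφ₀ : Measurable φ₀)
    (hφ₀_bdd : ∃ B : ℝ, ∀ p ∈ Icc (0 : ℝ) 1 ×ˢ Icc (0 : ℝ) 1, |φ₀ p| ≤ B)
    (hY : ∀ i, ∀ᵐ ω ∂μ, Y i ω = φ₀ (X i ω, Z i ω) + ξ i ω)
    -- the class `H` is centered and has a square integrable envelope
    (hH_meas : ∀ h ∈ H, Measurable h)
    (hH_centered : ∀ h ∈ H, ∫ z, h z ∂uniformLaw = 0)
    (hH_env : ∀ h ∈ H, ∀ z ∈ Icc (0 : ℝ) 1, |h z| ≤ env z)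
    (h_env : MemLp env 2 uniformLaw) :
    (∀ f h : ℕ → Ω → ℝ → ℝ,
      (∀ n, 1 ≤ n → ∀ᵐ ω ∂μ,
        IsAdditiveLSE isotonicModel H (fun i : Fin n => X i ω) (fun i => Z i ω) (fun i => Y i ω)
          (f n ω) (h n ω) ∧
        IsCanonicalStep (fun i : Fin n => X i ω) (f n ω)) →
      StochasticallyBounded μ (fun n ω => supNorm (f n ω))) ∧
    (∀ f h : ℕ → Ω → ℝ → ℝ,
      (∀ n, 1 ≤ n → ∀ᵐ ω ∂μ,
        IsAdditiveLSE convexModel H (fun i : Fin n => X i ω) (fun i => Z i ω) (fun i => Y i ω)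
          (f n ω) (h n ω) ∧
        IsCanonicalPiecewiseLinear (fun i : Fin n => X i ω) (f n ω)) →
      StochasticallyBounded μ (fun n ω => supNorm (f n ω))) := by

  obtain ⟨B₀, hB₀⟩ := hφ₀_bdd
  set B := max B₀ 0 with hBdef
  have hB : 0 ≤ B := le_max_right _ _
  have hsq : MeasurableSet (Icc (0 : ℝ) 1) := measurableSet_Icc
  -- marginal laws
  have hXlaw : ∀ i, μ.map (X i) = uniformLaw := fun i => by
    have := congrArg (Measure.map Prod.fst) (hXZ_law i)
    rw [Measure.map_map measurable_fst ((hX i).prodMk (hZ i)), Measure.map_fst_prod] at this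
    simpa [Function.comp_def] using this
  have hZlaw : ∀ i, μ.map (Z i) = uniformLaw := fun i => by
    have := congrArg (Measure.map Prod.snd) (hXZ_law i)
    rw [Measure.map_map measurable_snd ((hX i).prodMk (hZ i)), Measure.map_snd_prod] at this
    simpa [Function.comp_def] using this
  have hXZ_ind : ∀ i, IndepFun (X i) (Z i) μ := fun i =>
    (indepFun_iff_map_prod_eq_prod_map_map (hX i).aemeasurable (hZ i).aemeasurable).2
      (by rw [hXZ_law, hXlaw, hZlaw])
  have hmem : ∀ᵐ t ∂uniformLaw, t ∈ Icc (0 : ℝ) 1 := ae_restrict_mem hsq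
  have hXmem : ∀ᵐ ω ∂μ, ∀ i, X i ω ∈ Icc (0 : ℝ) 1 :=
    ae_all_iff.2 fun i => ae_of_ae_map (hX i).aemeasurable (by rw [hXlaw]; exact hmem)
  have hZmem : ∀ᵐ ω ∂μ, ∀ i, Z i ω ∈ Icc (0 : ℝ) 1 :=
    ae_all_iff.2 fun i => ae_of_ae_map (hZ i).aemeasurable (by rw [hZlaw]; exact hmem)
  -- a measurable version of the envelope
  set e : ℝ → ℝ := h_env.1.mk env with he
  have hem : Measurable e := h_env.1.stronglyMeasurable_mk.measurable
  have hemem : MemLp e 2 uniformLaw := h_env.ae_eq h_env.1.ae_eq_mk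
  have heZ : ∀ᵐ ω ∂μ, ∀ i, env (Z i ω) = e (Z i ω) :=
    ae_all_iff.2 fun i => ae_of_ae_map (hZ i).aemeasurable (by rw [hZlaw]; exact h_env.1.ae_eq_mk)
  -- the marks
  have hξ2 : MemLp (ξ 0) 2 μ := memLp_two_of_lorentzNorm_lt_top (hξ 0) hξ_norm
  have hpairXZ : Pairwise fun i j => IndepFun (fun ω => (X i ω, Z i ω)) (fun ω => (X j ω, Z j ω)) μ :=
    fun i j hij => hXZ_indep.indepFun hij
  have hmeasfst : Measurable fun (p : ℕ → ℝ × ℝ) i => (p i).1 := by fun_prop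
  have hXξ : IndepFun (fun ω i => X i ω) (fun ω i => ξ i ω) μ :=
    hXZξ.comp (φ := fun (p : ℕ → ℝ × ℝ) i => (p i).1) (ψ := id) hmeasfst measurable_id
  have hV : IsMarkedUniform μ X (fun i ω => |ξ i ω|) (∫ ω, |ξ 0 ω| ∂μ) (∫ ω, |ξ 0 ω| ^ 2 ∂μ) :=
    { measurable_loc := hX
      measurable_mark := fun i => (hξ i).abs
      map_loc := hXlaw
      indep := fun i => hXξ.comp (φ := fun x : ℕ → ℝ => x i)
        (ψ := fun y : ℕ → ℝ => |y i|) (measurable_pi_apply i)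
        (measurable_pi_apply i).abs
      pairwise_indep := fun i j hij => by
        refine (pairwise_indepFun_prodMk hX hξ
          (fun i j hij => (hpairXZ hij).comp measurable_fst measurable_fst)
          (fun i j hij => hξ_indep.indepFun hij) hXξ hij).comp
          (φ := fun p : ℝ × ℝ => (p.1, |p.2|)) (ψ := fun p : ℝ × ℝ => (p.1, |p.2|))
          (measurable_fst.prodMk measurable_snd.abs) (measurable_fst.prodMk measurable_snd.abs)
      memLp := fun i => ((hξ_ident i).symm.memLp_snd hξ2).abs
      nonneg := fun i ω => abs_nonneg _
      integral_le := fun i => ((hξ_ident i).comp (u := fun t => |t|) (by fun_prop)).integral_eq.le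
      integral_sq_le := fun i =>
        ((hξ_ident i).comp (u := fun t => |t| ^ 2) (by fun_prop)).integral_eq.le }
  have hV' : IsMarkedUniform μ X (fun i ω => |e (Z i ω)|) (∫ z, |e z| ∂uniformLaw)
      (∫ z, |e z| ^ 2 ∂uniformLaw) :=
    { measurable_loc := hX
      measurable_mark := fun i => (hem.comp (hZ i)).abs
      map_loc := hXlaw
      indep := fun i => (hXZ_ind i).comp (φ := id) (ψ := fun z => |e z|) measurable_id hem.abs
      pairwise_indep := fun i j hij => (hpairXZ hij).comp
        (φ := fun p : ℝ × ℝ => (p.1, |e p.2|)) (ψ := fun p : ℝ × ℝ => (p.1, |e p.2|))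
        (measurable_fst.prodMk (hem.comp measurable_snd).abs)
        (measurable_fst.prodMk (hem.comp measurable_snd).abs)
      memLp := fun i => by
        have : MemLp e 2 (μ.map (Z i)) := by rw [hZlaw]; exact hemem
        exact (this.comp_of_map (hZ i).aemeasurable).abs
      nonneg := fun i ω => abs_nonneg _
      integral_le := fun i => by
        rw [← hZlaw i, integral_map (hZ i).aemeasurable hem.abs.aestronglyMeasurable]
      integral_sq_le := fun i => by
        rw [← hZlaw i, integral_map (hZ i).aemeasurable (hem.abs.pow_const 2).aestronglyMeasurable] }
  -- the responses of the least squares problem for `f` are dominated by the marks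
  have hdom : ∀ᵐ ω ∂μ, ∀ h ∈ H, ∀ i, |Y i ω - h (Z i ω)| ≤ B + |ξ i ω| + |e (Z i ω)| := by
    -- The exceptional null set does not depend on `h`, so the bound applies to the random `ĥ`
    -- without any measurability in `ω`.
    filter_upwards [hXmem, hZmem, heZ, ae_all_iff.2 hY] with ω h1 h2 h3 h4 h hh i
    have a1 : |φ₀ (X i ω, Z i ω)| ≤ B := (hB₀ _ ⟨h1 i, h2 i⟩).trans (le_max_left _ _)
    have a2 := hH_env h hh _ (h2 i)
    rw [h3] at a2
    rw [h4]
    calc |φ₀ (X i ω, Z i ω) + ξ i ω - h (Z i ω)|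
        ≤ |φ₀ (X i ω, Z i ω) + ξ i ω| + |h (Z i ω)| := abs_sub _ _
      _ ≤ |φ₀ (X i ω, Z i ω)| + |ξ i ω| + |h (Z i ω)| := by gcongr; exact abs_add_le _ _
      _ ≤ _ := add_le_add (add_le_add a1 le_rfl) (a2.trans (le_abs_self _))
  constructor
  · intro f h hfh
    refine stochasticallyBounded_of_isotonic hV hV' hB hXmem fun n hn => ?_
    filter_upwards [hdom, hfh n hn] with ω h1 h2
    exact ⟨_, fun i => h1 _ h2.1.1.2 i, h2.1.isLeastSquaresFit, h2.2⟩
  · intro f h hfh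
    refine stochasticallyBounded_of_convex hV hV' hB hXmem fun n hn => ?_
    filter_upwards [hdom, hfh n hn] with ω h1 h2
    exact ⟨_, fun i => h1 _ h2.1.1.2 i, h2.1.isLeastSquaresFit, h2.2⟩
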